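/- Notation. $T_xf(t)=f(t-x)$ and $M_xf(t)=e^{2\pi i x t}f(t)$ for $f\in L^2(\mathbb R)$; $\operatorname{supp}$ is the essential support (the complement of the largest open set on which the function vanishes a.e.). A family $(\phi_\lambda)$ in $L^2(\mathbb R)$ is a frame if $A\|f\|^2\le\sum_\lambda|\langle f,\phi_\lambda\rangle|^2\le B\|f\|^2$ for all $f\in L^2(\mathbb R)$ and some $0<A\le B<\infty$; its frame operator is $\mathbf Sf=\sum_\lambda\langle f,\phi_\lambda\rangle\phi_\lambda$, and all series below converge unconditionally in $L^2(\mathbb R)$. (a) Let $g_n\in L^2(\mathbb R)$ and $b_n,c_n,d_n\in\mathbb R$ ($n\in\mathbb Z$) be such that $c_n<d_n$, $\operatorname{supp}(g_n)=[c_n,d_n]$, $b_n>\frac1{d_n-c_n}$ and $d_{n-1}\le c_{n+1}$ for all $n\in\mathbb Z$. Assume that there is $\epsilon>0$ with $b_n^{-1}\ge\max\{\frac{d_n-c_n}2,\;c_{n+1}-c_n,\;d_n-d_{n-1}\}+\epsilon$ for all $n$, that $0<b_n<\dfrac{b_{n-1}}{b_{n-1}(d_n-c_{n-1})-1}$ for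 all $n$, and that the nonstationary Gabor system $(M_{mb_n}g_n)_{m,n\in\mathbb Z}$ is a frame. Then its frame operator $\mathbf S$ is a bounded, boundedly invertible operator on $L^2(\mathbb R)$, and there are $\omega_0,\omega_{n,\pm1}\in L^\infty(\mathbb R)$ ($n\in\mathbb Z$) with $$\mathbf S^{-1}f=\omega_0f+\sum_{n\in\mathbb Z}\left(\omega_{n,1}T_{-b_n^{-1}}f+\omega_{n,-1}T_{b_n^{-1}}f\right)\quad\text{for all }f\in L^2(\mathbb R),$$ $$\operatorname{supp}(\omega_{n,1})\subseteq I^-_{n,1}:=[c_n,\,d_n-b_n^{-1}],\qquad\operatorname{supp}(\omega_{n,-1})\subseteq I^+_{n,1}:=[c_n+b_n^{-1},\,d_n]\quad\text{for all }n\in\mathbb Z.$$ The operator $\mathbf S$ has a representation of the same form, with the same support conditions but possibly different weights in $L^\infty(\mathbb R)$. (b) Let $g\in L^2(\mathbb R)$ and $c<d$ with $\operatorname{supp}(g)\subseteq[c,d]$, let $\frac{d-c}2\le a<d-c$, $0<b<\frac1a$ and $b<\frac2{d-c+a}$, and assume that the Gabor system $(M_{mb}T_{na}g)_{m,n\in\mathbb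 Z}$ is a frame. Then its frame operator $\mathbf S$ is a bounded, boundedly invertible operator on $L^2(\mathbb R)$, and there are $\omega_{-1},\omega_0,\omega_1\in L^\infty(\mathbb R)$ with $$\mathbf S^{-1}f=\sum_{k\in\{-1,0,1\}}\omega_kT_{-kb^{-1}}f\quad\text{for all }f\in L^2(\mathbb R),$$ where $\omega_1=0$ a.e. outside $\bigcup_{n\in\mathbb Z}\left([c,\,d-b^{-1}]+na\right)$ and $\omega_{-1}=0$ a.e. outside $\bigcup_{n\in\mathbb Z}\left([c+b^{-1},\,d]+na\right)$. The operator $\mathbf S$ has a representation of the same form, with the same support conditions but possibly different weights in $L^\infty(\mathbb R)$. -/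

import Mathlib

open MeasureTheory Filter Topology
open scoped ENNReal

noncomputable section

namespace NSGabor

/-- The Hilbert space `L²(ℝ)` of complex-valued functions. -/
abbrev L2 : Type := Lp ℂ 2 (volume : Measure ℝ)

/-- The space `L^∞(ℝ)` of essentially bounded complex-valued functions. -/
abbrev Linf : Type := Lp ℂ ∞ (volume : Measure ℝ)

/-- The translation operator `(T_x f)(t) = f (t - x)`. -/
def translate (x : ℝ) (f : L2) : L2 :=
  Lp.compMeasurePreserving (fun t : ℝ => t - x) (measurePreserving_sub_right volume x) f

lemma coeFn_translate (x : ℝ) (f : L2) :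
    (translate x f : ℝ → ℂ) =ᵐ[volume] fun t => f (t - x) :=
  Lp.coeFn_compMeasurePreserving f (measurePreserving_sub_right volume x)

/-- The function `t ↦ exp (2π i x t) f t` is square integrable when `f` is. -/
lemma memLp_modulate (x : ℝ) (f : L2) :
    MemLp (fun t : ℝ => Complex.exp (2 * Real.pi * Complex.I * x * t) * f t) 2 volume := by
  refine (Lp.memLp f).of_le ?_ ?_
  · exact (Continuous.aestronglyMeasurable (by fun_prop)).mul (Lp.aestronglyMeasurable f)
  · refine Eventually.of_forall fun t => ?_
    have h : (2 * Real.pi * Complex.I * x * t : ℂ) = ((2 * Real.pi * x * t : ℝ) : ℂ) * Complex.I := by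
      push_cast; ring
    rw [norm_mul, h, Complex.norm_exp_ofReal_mul_I, one_mul]

/-- The modulation operator `(M_x f)(t) = exp (2π i x t) f t`. -/
def modulate (x : ℝ) (f : L2) : L2 := (memLp_modulate x f).toLp _

/-- The pointwise product of a weight `w ∈ L^∞(ℝ)` with `f ∈ L²(ℝ)`. -/
def weightMul (w : Linf) (f : L2) : L2 := w • f

lemma coeFn_weightMul (w : Linf) (f : L2) :
    (weightMul w f : ℝ → ℂ) =ᵐ[volume] fun t => w t * f t :=
  Lp.coeFn_lpSMul w f

/-- The essential support of `f`: the complement of the largest open set on which `f` vanishes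
almost everywhere. -/
def essSupport (f : ℝ → ℂ) : Set ℝ :=
  (⋃₀ {U : Set ℝ | IsOpen U ∧ ∀ᵐ t ∂(volume : Measure ℝ), t ∈ U → f t = 0})ᶜ

/-- `φ` is a frame for `L²(ℝ)`. -/
def IsFrame {Λ : Type*} (φ : Λ → L2) : Prop :=
  ∃ A B : ℝ, 0 < A ∧ A ≤ B ∧ ∀ f : L2,
    Summable (fun l => ‖inner ℂ (φ l) f‖ ^ 2) ∧
    A * ‖f‖ ^ 2 ≤ ∑' l, ‖inner ℂ (φ l) f‖ ^ 2 ∧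
    ∑' l, ‖inner ℂ (φ l) f‖ ^ 2 ≤ B * ‖f‖ ^ 2

/-- `S` is the frame operator `S f = ∑ ⟨f, φ_l⟩ φ_l` of the system `φ`, the sum converging
unconditionally in `L²(ℝ)`. This determines `S`. (Mathlib's `inner ℂ` is linear in its second
argument.) -/
def IsFrameOperator {Λ : Type*} (φ : Λ → L2) (S : L2 → L2) : Prop :=
  ∀ f : L2, HasSum (fun l => inner ℂ (φ l) f • φ l) (S f)

/-- The nonstationary Gabor system `g_{m,n} = M_{m b_n} g_n`, indexed by `(m, n)`. -/
def nsgSystem (g : ℤ → L2) (b : ℤ → ℝ) : ℤ × ℤ → L2 :=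
  fun p => modulate (p.1 * b p.2) (g p.2)

/-- The Gabor system `g_{m,n} = M_{m b} T_{n a} g`, indexed by `(m, n)`. -/
def gaborSystem (g : L2) (a b : ℝ) : ℤ × ℤ → L2 :=
  fun p => modulate (p.1 * b) (translate (p.2 * a) g)

/-- The operator `W` has a Walnut-like representation on all of `L²(ℝ)` with weights `ω l` and
translation constants `a l`: the series `∑ ω_l T_{a_l} f` converges unconditionally to `W f`. -/
def HasWalnutRepresentation {Λ : Type*} (W : L2 →L[ℂ] L2) (ω : Λ → Linf) (a : Λ → ℝ) : Prop :=
  ∀ f : L2, HasSum (fun l => weightMul (ω l) (translate (a l) f)) (W f)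

/-- `B^+_{n,k} = ∑_{j<k} 1 / b_{n+j}`. -/
def Bplus (b : ℤ → ℝ) (n : ℤ) (k : ℕ) : ℝ := ∑ j ∈ Finset.range k, (b (n + j))⁻¹

/-- `B^-_{n,k} = ∑_{j<k} 1 / b_{n-j}`. -/
def Bminus (b : ℤ → ℝ) (n : ℤ) (k : ℕ) : ℝ := ∑ j ∈ Finset.range k, (b (n - j))⁻¹

/-- `I^+_{n,k} = [c_{n-k+1} + B^-_{n,k}, d_n]` for `k ≥ 1`. -/
def Iplus (c d b : ℤ → ℝ) (n : ℤ) (k : ℕ) : Set ℝ :=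
  Set.Icc (c (n - k + 1) + Bminus b n k) (d n)

/-- `I^-_{n,k} = [c_n, d_{n+k-1} - B^+_{n,k}]` for `k ≥ 1`. -/
def Iminus (c d b : ℤ → ℝ) (n : ℤ) (k : ℕ) : Set ℝ :=
  Set.Icc (c n) (d (n + k - 1) - Bplus b n k)

/-- The translation constant `-sgn(k) B^{sgn(k)}_{n,|k|}`, for `k ≠ 0`. -/
def translationConst (b : ℤ → ℝ) (n k : ℤ) : ℝ :=
  if 0 < k then -Bplus b n k.natAbs else Bminus b n k.natAbs

/-- `W f = ω₀ f + ∑_{n ∈ ℤ} ∑_{k ∈ {-1, 1}} ω_{n,k} T_{-sgn(k) B^{sgn(k)}_{n,|k|}} f` for all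
`f ∈ L²(ℝ)`, with weights in `L^∞(ℝ)` satisfying `supp ω_{n,1} ⊆ I^-_{n,1}` and
`supp ω_{n,-1} ⊆ I^+_{n,1}`. The index `none` belongs to the term `ω₀ f`. -/
def HasTridiagonalWalnut (c d b : ℤ → ℝ) (W : L2 →L[ℂ] L2) : Prop :=
  ∃ (ω₀ : Linf) (ω : ℤ → ℤ → Linf),
    HasWalnutRepresentation (Λ := Option (ℤ × ({-1, 1} : Set ℤ))) W
      (fun o => o.elim ω₀ fun p => ω p.1 p.2)
      (fun o => o.elim 0 fun p => translationConst b p.1 p.2) ∧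
    ∀ n : ℤ, essSupport (ω n 1) ⊆ Iminus c d b n 1 ∧ essSupport (ω n (-1)) ⊆ Iplus c d b n 1

/-- `W f = ∑_{k ∈ {-1, 0, 1}} ω_k T_{-k/b} f` for all `f ∈ L²(ℝ)`, with weights in `L^∞(ℝ)` such
that `ω_1` vanishes outside `⋃_n [c, d - 1/b] + n a` and `ω_{-1}` vanishes outside
`⋃_n [c + 1/b, d] + n a`. -/
def HasTridiagonalGaborWalnut (c d a b : ℝ) (W : L2 →L[ℂ] L2) : Prop :=
  ∃ ω : ℤ → Linf,
    HasWalnutRepresentation (Λ := ({-1, 0, 1} : Set ℤ)) W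
      (fun k => ω k) (fun k => -((k : ℤ) : ℝ) * b⁻¹) ∧
    (∀ᵐ t ∂(volume : Measure ℝ),
      t ∉ ⋃ n : ℤ, Set.Icc (c + n * a) (d - b⁻¹ + n * a) → ω 1 t = 0) ∧
    (∀ᵐ t ∂(volume : Measure ℝ),
      t ∉ ⋃ n : ℤ, Set.Icc (c + b⁻¹ + n * a) (d + n * a) → ω (-1) t = 0)

end NSGabor

end

/-! Put p_n = 1/b_n. The n-th window contributes, by Parseval, p_n ∫ |F(t) + F(t + p_n)|² over [c_n,
c_n + p_n) to the frame sum of f, with F = conj(g_n) f; two periods suffice because d_n - c_n ≤ 2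
p_n. The cross terms live on the cells [c_n, d_n - p_n) and [c_n + p_n, d_n), which are translates
of each other by p_n. The hypotheses make the cells of all windows pairwise disjoint
(`admissible_of_le`), so these translations glue to a single measure-preserving involution σ =
`swap`, and S f = D f + W (f ∘ σ) with W carried by the cells (`exists_frameOperator_eq_swapOp`).

Hence S acts on each pair {t, σ t} as a hermitian 2×2 matrix, and Cramer's rule gives an inverse of
the same shape, without further translations (`exists_swapOp_inverse`). The analytic point is that
the determinant stays away from zero. If R is the adjugate operator, then S R is multiplication by
the determinant; an antiunitary twist relates R to S, so both satisfy the lower bound A. Thus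
multiplication by the determinant is bounded below by A², which forces |det| ≥ A² almost everywhere.

Cutting W along the cells turns both operators into Walnut series; disjointness of the cells gives
unconditional convergence (`hasSum_of_disjoint`). -/

noncomputable section

namespace NSGabor

/-! ### Frame operators of general frames. -/

section Frame

variable {Λ : Type*} {φ : Λ → L2} {A B : ℝ}

/-- The Bessel inequality bounds the norm of finite synthesis sums. -/
lemma norm_sq_sum_smul_le (hB : 0 ≤ B)
    (h : ∀ (f : L2) (s : Finset Λ), ∑ l ∈ s, ‖inner ℂ (φ l) f‖ ^ 2 ≤ B * ‖f‖ ^ 2)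
    (c : Λ → ℂ) (s : Finset Λ) :
    ‖∑ l ∈ s, c l • φ l‖ ^ 2 ≤ B * ∑ l ∈ s, ‖c l‖ ^ 2 := by
  set v := ∑ l ∈ s, c l • φ l with hv
  have h1 : ‖v‖ ^ 2 ≤ ∑ l ∈ s, ‖c l‖ * ‖inner ℂ (φ l) v‖ := by
    have : (inner ℂ v v : ℂ) = ∑ l ∈ s, starRingEnd ℂ (c l) * inner ℂ (φ l) v := by
      conv_lhs => rw [hv, sum_inner]
      simp only [inner_smul_left]
      rfl
    calc ‖v‖ ^ 2 = ‖(inner ℂ v v : ℂ)‖ := by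
          rw [inner_self_eq_norm_sq_to_K]; simp
      _ ≤ ∑ l ∈ s, ‖starRingEnd ℂ (c l) * inner ℂ (φ l) v‖ := by
          rw [this]; exact norm_sum_le _ _
      _ = _ := by simp
  have h2 := Finset.sum_mul_sq_le_sq_mul_sq s (fun l => ‖c l‖) (fun l => ‖inner ℂ (φ l) v‖)
  have h3 := h v s
  have h4 : 0 ≤ ∑ l ∈ s, ‖c l‖ ^ 2 := Finset.sum_nonneg fun _ _ => by positivity
  by_cases hz : ‖v‖ ^ 2 = 0
  · rw [hz]; positivity
  have hp : 0 < ‖v‖ ^ 2 := lt_of_le_of_ne (by positivity) (Ne.symm hz)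
  have h5 : (‖v‖ ^ 2) ^ 2 ≤ (∑ l ∈ s, ‖c l‖ ^ 2) * (B * ‖v‖ ^ 2) :=
    calc (‖v‖ ^ 2) ^ 2 ≤ (∑ l ∈ s, ‖c l‖ * ‖inner ℂ (φ l) v‖) ^ 2 := by gcongr
      _ ≤ _ := h2
      _ ≤ _ := by gcongr
  have h6 : ‖v‖ ^ 2 * ‖v‖ ^ 2 ≤ (B * ∑ l ∈ s, ‖c l‖ ^ 2) * ‖v‖ ^ 2 := by nlinarith
  exact le_of_mul_le_mul_right h6 hp

lemma summable_smul_of_bessel (hB : 0 ≤ B)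
    (h : ∀ (f : L2) (s : Finset Λ), ∑ l ∈ s, ‖inner ℂ (φ l) f‖ ^ 2 ≤ B * ‖f‖ ^ 2)
    (c : Λ → ℂ) (hc : Summable fun l => ‖c l‖ ^ 2) : Summable fun l => c l • φ l := by
  rw [summable_iff_vanishing_norm] at hc ⊢
  intro ε hε
  -- The shift `B + 1` keeps the quotient meaningful when `B = 0`.
  obtain ⟨s, hs⟩ := hc (ε ^ 2 / (B + 1)) (by positivity)
  refine ⟨s, fun t ht => ?_⟩
  have h1 := hs t ht
  have h2 := norm_sq_sum_smul_le hB h c t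
  have h4 : 0 ≤ ∑ l ∈ t, ‖c l‖ ^ 2 := Finset.sum_nonneg fun _ _ => by positivity
  rw [Real.norm_of_nonneg h4, lt_div_iff₀ (by positivity)] at h1
  have : ‖∑ l ∈ t, c l • φ l‖ ^ 2 < ε ^ 2 := by nlinarith
  exact lt_of_pow_lt_pow_left₀ 2 hε.le this

/-- The frame operator of a frame is a bounded, boundedly invertible operator. -/
theorem exists_frameOperator (h : IsFrame φ) :
    ∃ S : L2 ≃L[ℂ] L2, IsFrameOperator φ S ∧
      (∀ f, HasSum (fun l => ((‖inner ℂ (φ l) f‖ ^ 2 : ℝ) : ℂ)) (inner ℂ f (S f))) ∧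
      (∃ A : ℝ, 0 < A ∧ ∀ f, A * ‖f‖ ≤ ‖S f‖) := by
  obtain ⟨A, B, hA, hAB, hf⟩ := h
  have hB : 0 ≤ B := hA.le.trans hAB
  have hb : ∀ (f : L2) (s : Finset Λ), ∑ l ∈ s, ‖inner ℂ (φ l) f‖ ^ 2 ≤ B * ‖f‖ ^ 2 :=
    fun f s => ((hf f).1.sum_le_tsum s fun _ _ => by positivity).trans (hf f).2.2
  have hs : ∀ f : L2, Summable fun l => (inner ℂ (φ l) f : ℂ) • φ l := fun f =>
    summable_smul_of_bessel hB hb _ (hf f).1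
  let S₀ : L2 →ₗ[ℂ] L2 :=
    { toFun := fun f => ∑' l, (inner ℂ (φ l) f : ℂ) • φ l
      map_add' := fun f g => by
        rw [← (hs f).tsum_add (hs g)]
        simp only [inner_add_right, add_smul]
      map_smul' := fun c f => by
        simp only [inner_smul_right, RingHom.id_apply, mul_smul]
        rw [(hs f).tsum_const_smul] }
  have hbd : ∀ f, ‖S₀ f‖ ≤ B * ‖f‖ := fun f => by
    refine le_of_tendsto (hs f).hasSum.norm (Eventually.of_forall fun s => ?_)
    have h1 := norm_sq_sum_smul_le hB hb (fun l => inner ℂ (φ l) f) s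
    have h2 := hb f s
    have : ‖∑ l ∈ s, (inner ℂ (φ l) f : ℂ) • φ l‖ ^ 2 ≤ (B * ‖f‖) ^ 2 := by nlinarith
    exact (sq_le_sq₀ (norm_nonneg _) (by positivity)).1 this
  let S₁ : L2 →L[ℂ] L2 := S₀.mkContinuous B hbd
  have hS₁ : ∀ f, HasSum (fun l => (inner ℂ (φ l) f : ℂ) • φ l) (S₁ f) := fun f => (hs f).hasSum
  have hq : ∀ f, HasSum (fun l => ((‖inner ℂ (φ l) f‖ ^ 2 : ℝ) : ℂ)) (inner ℂ f (S₁ f)) := fun f => by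
    refine ((hS₁ f).mapL (innerSL ℂ f)).congr_fun fun l => ?_
    rw [innerSL_apply_apply, inner_smul_right, ← inner_conj_symm f (φ l), Complex.mul_conj,
      Complex.normSq_eq_norm_sq]
  have hlow : ∀ f, A * ‖f‖ ^ 2 ≤ (inner ℂ (S₁ f) f : ℂ).re := fun f => by
    have h1 := Complex.hasSum_re (hq f)
    simp only [Complex.ofReal_re] at h1
    rw [← inner_conj_symm, Complex.conj_re, ← h1.tsum_eq]
    exact (hf f).2.1
  -- The lower frame bound makes the form of `S₁` coercive, so invertibility is Lax–Milgram.
  have hu : IsUnit S₁ := by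
    refine ContinuousLinearMap.isUnit_of_forall_le_norm_inner_map S₁ (c := ⟨A, hA.le⟩) hA fun f => ?_
    have := (hlow f).trans (Complex.re_le_norm _)
    rw [mul_comm]
    exact this
  obtain ⟨e, he⟩ := hu
  let S : L2 ≃L[ℂ] L2 := ContinuousLinearEquiv.unitsEquiv ℂ L2 e
  have hS : ∀ f, S f = S₁ f := fun f => by rw [← he]; rfl
  refine ⟨S, fun f => by rw [hS]; exact hS₁ f, fun f => by rw [hS]; exact hq f, A, hA, fun f => ?_⟩
  rw [hS]
  by_cases hz : ‖f‖ = 0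
  · rw [hz]; simp
  have hp : 0 < ‖f‖ := lt_of_le_of_ne (norm_nonneg _) (Ne.symm hz)
  have h1 := (hlow f).trans ((Complex.re_le_norm _).trans (norm_inner_le_norm (𝕜 := ℂ) _ _))
  refine le_of_mul_le_mul_right ?_ hp
  nlinarith

end Frame

/-! ### Multiplication operators and operators coupling points in pairs. -/

lemma enorm_sq_eq_lintegral (f : L2) : ‖f‖ₑ ^ 2 = ∫⁻ t, ‖f t‖ₑ ^ 2 := by
  have h := eLpNorm_nnreal_pow_eq_lintegral (f := (f : ℝ → ℂ)) (μ := volume) (p := 2) two_ne_zero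
  rw [Lp.enorm_def]
  simpa using h

/-- A multiplication operator that is bounded below has a weight that is bounded below. -/
lemma ae_le_norm_of_forall_norm_le (m : Linf) {κ : ℝ}
    (h : ∀ f : L2, κ * ‖f‖ ≤ ‖weightMul m f‖) : ∀ᵐ t, κ ≤ ‖m t‖ := by
  have hm : (fun _ => ENNReal.ofReal κ ^ 2) ≤ᵐ[volume] fun t => ‖m t‖ₑ ^ 2 := by
    -- Testing on the indicator of a set s of finite measure gives κ² |s| ≤ ∫_s |m|².
    refine ae_le_of_forall_setLIntegral_le_of_sigmaFinite (by fun_prop) fun s hs hfin => ?_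
    set f : L2 := indicatorConstLp 2 hs hfin.ne (1 : ℂ) with hf
    have h1 : ENNReal.ofReal κ * ‖f‖ₑ ≤ ‖weightMul m f‖ₑ := by
      have := ENNReal.ofReal_le_ofReal (h f)
      rwa [ENNReal.ofReal_mul' (norm_nonneg _), ofReal_norm, ofReal_norm] at this
    have h2 : (ENNReal.ofReal κ * ‖f‖ₑ) ^ 2 ≤ ‖weightMul m f‖ₑ ^ 2 := by gcongr
    have hfc : ∀ᵐ t, f t = s.indicator (fun _ => (1 : ℂ)) t := indicatorConstLp_coeFn
    rw [mul_pow, enorm_sq_eq_lintegral, enorm_sq_eq_lintegral] at h2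
    have h3 : ∫⁻ t, ‖f t‖ₑ ^ 2 = volume s := by
      rw [← lintegral_indicator_one hs]
      refine lintegral_congr_ae ?_
      filter_upwards [hfc] with t ht
      rw [ht]
      by_cases hts : t ∈ s <;> simp [hts]
    have h4 : ∫⁻ t, ‖weightMul m f t‖ₑ ^ 2 = ∫⁻ t in s, ‖m t‖ₑ ^ 2 := by
      rw [← lintegral_indicator hs]
      refine lintegral_congr_ae ?_
      filter_upwards [hfc, coeFn_weightMul m f] with t ht ht'
      rw [ht', ht]
      by_cases hts : t ∈ s <;> simp [hts]
    rw [h3, h4] at h2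
    simpa using h2
  filter_upwards [hm] with t ht
  have ht1 : ENNReal.ofReal κ ≤ ‖m t‖ₑ := (ENNReal.pow_le_pow_left_iff two_ne_zero).1 ht
  rw [← ofReal_norm] at ht1
  exact (ENNReal.ofReal_le_ofReal_iff (norm_nonneg _)).1 ht1

/-- Multiplication by a bounded weight as a bounded operator. -/
def weightMulL (w : Linf) : L2 →L[ℂ] L2 :=
  LinearMap.mkContinuous
    { toFun := weightMul w
      map_add' := fun f g => Lp.add_smul w f g
      map_smul' := fun c f => by
        apply Lp.ext
        filter_upwards [coeFn_weightMul w (c • f), coeFn_weightMul w f, Lp.coeFn_smul c f,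
          Lp.coeFn_smul c (weightMul w f)] with t h1 h2 h3 h4
        simp only [RingHom.id_apply]
        rw [h1, h4, Pi.smul_apply, h2, h3, Pi.smul_apply, smul_eq_mul, smul_eq_mul]
        ring }
    ‖w‖ (fun f => Lp.norm_smul_le w f)

section Involution

variable {σ : ℝ → ℝ} (hσ : MeasurePreserving σ volume volume)

/-- The operator `f ↦ D f + W (f ∘ σ)`. -/
def swapOp (D W : Linf) : L2 →L[ℂ] L2 :=
  weightMulL D +
    (weightMulL W).comp (Lp.compMeasurePreservingₗᵢ ℂ σ hσ).toContinuousLinearMap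

lemma coeFn_swapOp (D W : Linf) (f : L2) :
    ∀ᵐ t, swapOp hσ D W f t = D t * f t + W t * f (σ t) := by
  have h : swapOp hσ D W f = weightMul D f + weightMul W (Lp.compMeasurePreserving σ hσ f) := rfl
  filter_upwards [Lp.coeFn_add (weightMul D f) (weightMul W (Lp.compMeasurePreserving σ hσ f)),
    coeFn_weightMul D f, coeFn_weightMul W (Lp.compMeasurePreserving σ hσ f),
    Lp.coeFn_compMeasurePreserving f hσ] with t h1 h2 h3 h4
  rw [h, h1, Pi.add_apply, h2, h3, h4, Function.comp_apply]

lemma coeFn_swapOp_toLp {D W : ℝ → ℂ} (hD : MemLp D ∞ volume) (hW : MemLp W ∞ volume) (f : L2) :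
    ∀ᵐ t, swapOp hσ (hD.toLp D) (hW.toLp W) f t = D t * f t + W t * f (σ t) := by
  filter_upwards [coeFn_swapOp hσ (hD.toLp D) (hW.toLp W) f, hD.coeFn_toLp, hW.coeFn_toLp]
    with t h1 h2 h3
  rw [h1, h2, h3]

/-- If `f ↦ D f + W (f ∘ σ)` is bounded below, where `D` is real and `W` is hermitian with respect
to the involution `σ`, then it has a right inverse of the same form. -/
theorem exists_swapOp_inverse (hσσ : ∀ t, σ (σ t) = t) {D W s : ℝ → ℂ}
    (hD : MemLp D ∞ volume) (hW : MemLp W ∞ volume)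
    (hDr : ∀ t, starRingEnd ℂ (D t) = D t) (hWσ : ∀ t, W (σ t) = starRingEnd ℂ (W t))
    (hs : Measurable s) (hs1 : ∀ t, s t = 1 ∨ s t = -1) (hsσ : ∀ t, W t ≠ 0 → s (σ t) = -s t)
    {A : ℝ} (hA : 0 < A) (hlow : ∀ f, A * ‖f‖ ≤ ‖swapOp hσ (hD.toLp D) (hW.toLp W) f‖) :
    ∃ (D' W' : ℝ → ℂ) (hD' : MemLp D' ∞ volume) (hW' : MemLp W' ∞ volume),
      (∀ t, W t = 0 → W' t = 0) ∧ ∀ f,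
        swapOp hσ (hD.toLp D) (hW.toLp W) (swapOp hσ (hD'.toLp D') (hW'.toLp W') f) = f := by
  have hDσ : MemLp (fun t => D (σ t)) ∞ volume := hD.comp_measurePreserving hσ
  have hWσ' : MemLp (fun t => W (σ t)) ∞ volume := hW.comp_measurePreserving hσ
  have hWn : MemLp (fun t => -W t) ∞ volume := hW.neg
  -- On the pair (t, σ t) the operator is the matrix with rows (D t, W t) and (W (σ t), D (σ t)).
  -- Here `det` is its determinant, and `R` below acts by its adjugate.
  set det : ℝ → ℂ := fun t => D t * D (σ t) - W t * W (σ t) with hdet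
  have hdetm : MemLp det ∞ volume := (hDσ.mul hD).sub (hWσ'.mul hW)
  have hdetσ : ∀ t, det (σ t) = det t := fun t => by simp only [hdet, hσσ]; ring
  set S := swapOp hσ (hD.toLp D) (hW.toLp W) with hS
  set R := swapOp hσ (hDσ.toLp _) (hWn.toLp _) with hR
  have hσae : ∀ {p : ℝ → Prop}, (∀ᵐ t, p t) → ∀ᵐ t, p (σ t) := fun h =>
    hσ.quasiMeasurePreserving.ae h
  have hSR : ∀ f, S (R f) = weightMul (hdetm.toLp _) f := fun f => by
    apply Lp.ext
    filter_upwards [coeFn_swapOp_toLp hσ hD hW (R f), coeFn_swapOp_toLp hσ hDσ hWn f,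
      hσae (coeFn_swapOp_toLp hσ hDσ hWn f), coeFn_weightMul (hdetm.toLp _) f,
      hdetm.coeFn_toLp] with t h1 h2 h3 h4 h5
    rw [h1, h2, h3, h4, h5, hσσ]
    ring
  -- With f' = s · conj(f ∘ σ) one has (S f') ∘ σ = (s ∘ σ) · conj(R f): the sign change of s under
  -- σ supplies the minus sign in front of W. Both maps preserve norms, so R inherits the lower
  -- bound of S.
  have hRlow : ∀ f, A * ‖f‖ ≤ ‖R f‖ := fun f => by
    have hf' : MemLp (fun t => s t * starRingEnd ℂ (f (σ t))) 2 volume := by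
      have h0 : MemLp (fun t => f (σ t)) 2 volume := (Lp.memLp f).comp_measurePreserving hσ
      refine h0.of_le ?_ (Eventually.of_forall fun t => ?_)
      · exact hs.aestronglyMeasurable.mul
          (Complex.continuous_conj.comp_aestronglyMeasurable h0.aestronglyMeasurable)
      · rcases hs1 t with h | h <;> simp [h]
    set f' : L2 := hf'.toLp _ with hf'def
    have hn1 : ‖f‖ ≤ ‖f'‖ := by
      have : ‖f'‖ = ‖Lp.compMeasurePreserving σ hσ f'‖ :=
        (Lp.norm_compMeasurePreserving f' hσ).symm
      rw [this]
      refine Lp.norm_le_norm_of_ae_le ?_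
      filter_upwards [Lp.coeFn_compMeasurePreserving f' hσ, hσae hf'.coeFn_toLp] with t h1 h2
      rw [h1, Function.comp_apply, h2, hσσ]
      rcases hs1 (σ t) with h | h <;> simp [h]
    have hn2 : ‖S f'‖ ≤ ‖R f‖ := by
      rw [← Lp.norm_compMeasurePreserving (S f') hσ]
      refine Lp.norm_le_norm_of_ae_le ?_
      filter_upwards [Lp.coeFn_compMeasurePreserving (S f') hσ,
        hσae (coeFn_swapOp_toLp hσ hD hW f'), coeFn_swapOp_toLp hσ hDσ hWn f,
        hσae hf'.coeFn_toLp, hf'.coeFn_toLp] with t h1 h2 h3 h4 h5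
      rw [h1, Function.comp_apply, h2, h3, h4, hσσ, h5, hWσ]
      have hkey : D (σ t) * (s (σ t) * starRingEnd ℂ (f t)) +
          starRingEnd ℂ (W t) * (s t * starRingEnd ℂ (f (σ t))) =
          s (σ t) * starRingEnd ℂ (D (σ t) * f t + -W t * f (σ t)) := by
        simp only [map_add, map_mul, map_neg, hDr]
        by_cases hw : W t = 0
        · simp [hw]; ring
        · rw [hsσ t hw]; ring
      rw [hkey, norm_mul, RCLike.norm_conj]
      rcases hs1 (σ t) with h | h <;> simp [h]
    calc A * ‖f‖ ≤ A * ‖f'‖ := by gcongr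
      _ ≤ ‖S f'‖ := hlow f'
      _ ≤ _ := hn2
  -- The lower bound enters twice: ‖det · f‖ = ‖S (R f)‖ ≥ A ‖R f‖ ≥ A² ‖f‖.
  have hdlow : ∀ᵐ t, A ^ 2 ≤ ‖det t‖ := by
    have := ae_le_norm_of_forall_norm_le (hdetm.toLp _) (κ := A ^ 2) fun f => by
      rw [← hSR]
      calc A ^ 2 * ‖f‖ = A * (A * ‖f‖) := by ring
        _ ≤ A * ‖R f‖ := by gcongr; exact hRlow f
        _ ≤ _ := hlow _
    filter_upwards [this, hdetm.coeFn_toLp] with t h1 h2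
    rwa [h2] at h1
  have hinv : MemLp (fun t => (det t)⁻¹) ∞ volume := by
    refine memLp_top_of_bound hdetm.aestronglyMeasurable.inv₀ (A ^ 2)⁻¹ ?_
    filter_upwards [hdlow] with t ht
    rw [norm_inv]
    exact inv_anti₀ (by positivity) ht
  -- Cramer's rule; since `det` is invariant under σ, the same factor serves both rows of the
  -- matrix.
  have hD' : MemLp (fun t => (det t)⁻¹ * D (σ t)) ∞ volume := hDσ.mul hinv
  have hW' : MemLp (fun t => (det t)⁻¹ * -W t) ∞ volume := hWn.mul hinv
  refine ⟨_, _, hD', hW', fun t ht => by simp [ht], fun f => ?_⟩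
  apply Lp.ext
  filter_upwards [coeFn_swapOp_toLp hσ hD hW (swapOp hσ (hD'.toLp _) (hW'.toLp _) f),
    coeFn_swapOp_toLp hσ hD' hW' f, hσae (coeFn_swapOp_toLp hσ hD' hW' f), hdlow]
    with t h1 h2 h3 h4
  rw [h1, h2, h3, hσσ, hdetσ]
  have h5 : det t ≠ 0 := fun h => by
    rw [h, norm_zero] at h4
    exact absurd h4 (not_le.2 (by positivity))
  have h6 : (det t)⁻¹ * (D t * D (σ t) - W t * W (σ t)) = 1 := inv_mul_cancel₀ h5
  linear_combination f t * h6

end Involution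

/-! ### The involution that exchanges the two cells of each window. -/

section Swap

variable (c d p : ℤ → ℝ)

/-- The intervals `[c_n, d_n - p_n)` and `[c_n + p_n, d_n)`. -/
def cell : ℤ × Bool → Set ℝ
  | (n, false) => Set.Ico (c n) (d n - p n)
  | (n, true) => Set.Ico (c n + p n) (d n)

/-- The translation that maps a cell to its partner. -/
def shift : ℤ × Bool → ℝ
  | (n, false) => p n
  | (n, true) => -p n

/-- The partner of a cell. -/
def partner (j : ℤ × Bool) : ℤ × Bool := (j.1, !j.2)

open Classical in
/-- The involution exchanging each cell with its partner by translation. -/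
def swap (t : ℝ) : ℝ :=
  if h : ∃ j, t ∈ cell c d p j then t + shift p h.choose else t

lemma partner_partner (j : ℤ × Bool) : partner (partner j) = j := by simp [partner]

lemma shift_partner (j : ℤ × Bool) : shift p (partner j) = -shift p j := by
  rcases j with ⟨n, _ | _⟩ <;> simp [partner, shift]

lemma add_shift_mem_cell_iff (t : ℝ) (j : ℤ × Bool) :
    t + shift p j ∈ cell c d p (partner j) ↔ t ∈ cell c d p j := by
  rcases j with ⟨n, _ | _⟩ <;> simp [partner, shift, cell]
  all_goals intros; constructor <;> intros <;> linarith

lemma measurableSet_cell (j : ℤ × Bool) : MeasurableSet (cell c d p j) := by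
  rcases j with ⟨n, _ | _⟩ <;> exact measurableSet_Ico

variable {c d p}

lemma swap_of_notMem {t : ℝ} (h : ∀ j, t ∉ cell c d p j) : swap c d p t = t := by
  rw [swap, dif_neg]
  push Not
  exact h

variable (hP : Pairwise (Function.onFun Disjoint (cell c d p)))
include hP

lemma eq_of_mem_cell {t : ℝ} {i j : ℤ × Bool} (hi : t ∈ cell c d p i) (hj : t ∈ cell c d p j) :
    i = j := by
  by_contra h
  exact Set.disjoint_left.1 (hP h) hi hj

lemma swap_of_mem {t : ℝ} {j : ℤ × Bool} (h : t ∈ cell c d p j) :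
    swap c d p t = t + shift p j := by
  have h' : ∃ j, t ∈ cell c d p j := ⟨j, h⟩
  rw [swap, dif_pos h', eq_of_mem_cell hP h'.choose_spec h]

lemma swap_mem_cell {t : ℝ} {j : ℤ × Bool} (h : t ∈ cell c d p j) :
    swap c d p t ∈ cell c d p (partner j) := by
  rw [swap_of_mem hP h]
  exact (add_shift_mem_cell_iff c d p t j).2 h

lemma swap_swap (t : ℝ) : swap c d p (swap c d p t) = t := by
  by_cases h : ∃ j, t ∈ cell c d p j
  · obtain ⟨j, hj⟩ := h
    rw [swap_of_mem hP (swap_mem_cell hP hj), swap_of_mem hP hj, shift_partner]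
    ring
  · push Not at h
    rw [swap_of_notMem h, swap_of_notMem h]

lemma swap_preimage_inter_cell (s : Set ℝ) (j : ℤ × Bool) :
    swap c d p ⁻¹' s ∩ cell c d p j = (fun t => t + shift p j) ⁻¹' (s ∩ cell c d p (partner j)) := by
  ext t
  simp only [Set.mem_inter_iff, Set.mem_preimage, add_shift_mem_cell_iff]
  refine and_congr_left fun h => ?_
  rw [swap_of_mem hP h]

omit hP in
lemma swap_preimage_diff (s : Set ℝ) :
    swap c d p ⁻¹' s \ ⋃ j, cell c d p j = s \ ⋃ j, cell c d p j := by
  ext t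
  simp only [Set.mem_sdiff, Set.mem_preimage, Set.mem_iUnion, not_exists]
  refine and_congr_left fun h => ?_
  rw [swap_of_notMem h]

lemma measurable_swap : Measurable (swap c d p) := by
  intro s hs
  rw [← Set.inter_union_sdiff (swap c d p ⁻¹' s) (⋃ j, cell c d p j), Set.inter_iUnion,
    swap_preimage_diff]
  refine .union (.iUnion fun j => ?_)
    (hs.diff (.iUnion fun j => measurableSet_cell c d p j))
  rw [swap_preimage_inter_cell hP]
  exact (hs.inter (measurableSet_cell c d p _)).preimage (by fun_prop)

lemma volume_inter_iUnion_cell {s : Set ℝ} (hs : MeasurableSet s) :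
    volume (s ∩ ⋃ j, cell c d p j) = ∑' j, volume (s ∩ cell c d p j) := by
  rw [Set.inter_iUnion]
  refine measure_iUnion (fun i j hij => ?_) fun j => hs.inter (measurableSet_cell c d p j)
  exact (hP hij).mono Set.inter_subset_right Set.inter_subset_right

/-- Off the cells `swap` is the identity. Inside a cell the preimage of s is a translate of the part
of s in the partner cell, so the measures match after reindexing the cells by `partner`. -/
lemma measurePreserving_swap : MeasurePreserving (swap c d p) volume volume := by
  have hm := measurable_swap hP
  refine ⟨hm, ?_⟩
  ext s hs
  have hE : MeasurableSet (⋃ j, cell c d p j) := .iUnion fun j => measurableSet_cell c d p j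
  rw [Measure.map_apply hm hs, ← measure_inter_add_sdiff (swap c d p ⁻¹' s) hE,
    ← measure_inter_add_sdiff s hE, swap_preimage_diff, volume_inter_iUnion_cell hP (hm hs),
    volume_inter_iUnion_cell hP hs]
  congr 1
  let e : ℤ × Bool ≃ ℤ × Bool := ⟨partner, partner, partner_partner, partner_partner⟩
  rw [← e.tsum_eq (fun j => volume (s ∩ cell c d p j))]
  refine tsum_congr fun j => ?_
  rw [swap_preimage_inter_cell hP, measure_preimage_add_right]
  rfl

end Swap

/-! ### Parseval's identity for one window and the resulting bounds. -/

/-- Parseval's identity for a function supported on two periods. -/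
theorem hasSum_sq_fourier_of_support {p x : ℝ} (hp : 0 < p) {F : ℝ → ℂ} (hF : MemLp F 2 volume)
    (hsupp : ∀ t, t ∉ Set.Ico x (x + 2 * p) → F t = 0) :
    HasSum (fun m : ℤ =>
        ‖∫ t : ℝ, Complex.exp (-(2 * Real.pi * Complex.I * (m * p⁻¹ : ℝ) * t)) * F t‖ ^ 2)
      (p * ∫ t in x..x + p, ‖F t + F (t + p)‖ ^ 2) := by
  have hxp : x < x + p := by linarith
  have hFp : MemLp (fun t => F (t + p)) 2 volume :=
    hF.comp_measurePreserving (measurePreserving_add_right volume p)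
  have h := hasSum_sq_fourierCoeffOn hxp ((hF.add hFp).restrict (Set.Ioc x (x + p)))
  -- Each integral over ℝ is p times a normalized Fourier coefficient; together with the 1/p in
  -- Parseval's identity this leaves one factor p.
  have h2 := h.mul_left (p ^ 2)
  set e : ℤ → ℝ → ℂ := fun m t =>
    Complex.exp (-(2 * Real.pi * Complex.I * (m * p⁻¹ : ℝ) * t)) with he
  have hper : ∀ m t, e m (t + p) = e m t := fun m t => by
    have hp' : (p : ℂ) ≠ 0 := by exact_mod_cast hp.ne'
    simp only [he]
    refine Complex.exp_eq_exp_iff_exists_int.2 ⟨-m, ?_⟩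
    push_cast
    field_simp
    ring
  have hint : ∀ m a b, IntervalIntegrable (fun t => e m t * F t) volume a b := fun m a b => by
    have hFi : IntervalIntegrable F volume a b :=
      ((hF.locallyIntegrable (by norm_num)).integrableOn_isCompact
        isCompact_uIcc).intervalIntegrable
    exact hFi.continuousOn_mul (by fun_prop)
  -- The characters have period p, so the second period of F folds onto the first.
  have hcoef : ∀ m : ℤ, (∫ t, e m t * F t) =
      p • fourierCoeffOn hxp (F + fun t => F (t + p)) m := fun m => by
    have h1 : (∫ t, e m t * F t) = ∫ t in x..x + 2 * p, e m t * F t := by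
      rw [intervalIntegral.integral_of_le (by linarith), ← integral_Ico_eq_integral_Ioc,
        setIntegral_eq_integral_of_forall_compl_eq_zero]
      intro t ht
      rw [hsupp t ht, mul_zero]
    have h2 : (∫ t in x + p..x + 2 * p, e m t * F t) = ∫ t in x..x + p, e m t * F (t + p) := by
      have := intervalIntegral.integral_comp_add_right (a := x) (b := x + p)
        (fun t => e m t * F t) p
      simp only [hper] at this
      rw [this]
      congr 1
      ring
    have hint' : IntervalIntegrable (fun t => e m t * F (t + p)) volume x (x + p) := by
      have hFi : IntervalIntegrable (fun t => F (t + p)) volume x (x + p) :=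
        ((hFp.locallyIntegrable (by norm_num)).integrableOn_isCompact
          isCompact_uIcc).intervalIntegrable
      exact hFi.continuousOn_mul (by fun_prop)
    rw [h1, ← intervalIntegral.integral_add_adjacent_intervals (hint m x (x + p))
      (hint m (x + p) (x + 2 * p)), h2, ← intervalIntegral.integral_add (hint m _ _) hint',
      fourierCoeffOn_eq_integral, smul_smul]
    have hpp : p * (1 / (x + p - x)) = 1 := by
      rw [add_sub_cancel_left]; field_simp
    rw [hpp, one_smul]
    refine intervalIntegral.integral_congr fun t _ => ?_
    simp only [Pi.add_apply, smul_eq_mul]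
    rw [fourier_coe_apply, ← mul_add]
    congr 1
    simp only [he, add_sub_cancel_left]
    congr 1
    push_cast
    field_simp
  rw [add_sub_cancel_left, smul_eq_mul, ← mul_assoc, sq p, mul_assoc p p, mul_inv_cancel₀ hp.ne',
    mul_one] at h2
  refine h2.congr_fun fun m => ?_
  rw [hcoef m, norm_smul, mul_pow, Real.norm_of_nonneg hp.le, sq p]

lemma inner_modulate (y : ℝ) (g f : L2) :
    (inner ℂ (modulate y g) f : ℂ) =
      ∫ t : ℝ, Complex.exp (-(2 * Real.pi * Complex.I * y * t)) * (starRingEnd ℂ (g t) * f t) := by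
  rw [L2.inner_def]
  refine integral_congr_ae ?_
  filter_upwards [(memLp_modulate y g).coeFn_toLp] with t ht
  rw [modulate, ht, RCLike.inner_apply, map_mul, ← Complex.exp_conj]
  simp only [map_mul, Complex.conj_I, Complex.conj_ofReal, map_ofNat]
  rw [show (2 * Real.pi * -Complex.I * y * t : ℂ) = -(2 * Real.pi * Complex.I * y * t) by ring]
  ring

/-- The generator of a Bessel sequence of modulations is bounded. -/
theorem mul_norm_sq_le_of_bessel {p B : ℝ} (hp : 0 < p) (g : L2)
    (h : ∀ f : L2, ∀ a, HasSum (fun m : ℤ => ‖inner ℂ (modulate (m * p⁻¹) g) f‖ ^ 2) a →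
      a ≤ B * ‖f‖ ^ 2) : ∀ᵐ t, p * ‖g t‖ ^ 2 ≤ B := by
  -- A test set u inside one period causes no overlap in the periodization, so Parseval turns the
  -- Bessel bound into p ∫_u |g|² ≤ B |u|.
  have hloc : ∀ x : ℝ, ∀ᵐ t, t ∈ Set.Ioc x (x + p) → p * ‖g t‖ ^ 2 ≤ B := by
    intro x
    rw [← ae_restrict_iff' measurableSet_Ioc]
    have hgi : Integrable (fun t => p * ‖g t‖ ^ 2) volume :=
      (((memLp_two_iff_integrable_sq_norm (Lp.aestronglyMeasurable g)).1 (Lp.memLp g))).const_mul p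
    refine ae_le_of_forall_setIntegral_le hgi.restrict (integrable_const B) fun s hs _ => ?_
    rw [Measure.restrict_restrict hs]
    set u := s ∩ Set.Ioc x (x + p) with hu
    have hum : MeasurableSet u := hs.inter measurableSet_Ioc
    have hfin : volume u < ∞ :=
      (measure_mono Set.inter_subset_right).trans_lt (by simp)
    set f : L2 := indicatorConstLp 2 hum hfin.ne (1 : ℂ) with hf
    have hfc : ∀ᵐ t, f t = u.indicator (fun _ => (1 : ℂ)) t := indicatorConstLp_coeFn
    have hgc : MemLp (fun t => starRingEnd ℂ (g t)) 2 volume := (Lp.memLp g).star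
    set F : ℝ → ℂ := u.indicator fun t => starRingEnd ℂ (g t) with hFdef
    have hF : MemLp F 2 volume := hgc.indicator hum
    have hFs : ∀ t, t ∉ Set.Ioc x (x + p) → F t = 0 := fun t ht =>
      Set.indicator_of_notMem (fun h => ht h.2) _
    have hpar := hasSum_sq_fourier_of_support hp (x := x) hF fun t ht => hFs t fun h => by
      exact ht ⟨h.1.le, by linarith [h.2]⟩
    have hle := h f _ (by
      convert hpar using 3 with m
      rw [inner_modulate]
      refine congrArg _ (integral_congr_ae ?_)
      filter_upwards [hfc] with t ht
      rw [ht, hFdef]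
      by_cases htu : t ∈ u <;> simp [htu])
    have hnf : ‖f‖ ^ 2 = (volume u).toReal := by
      rw [hf, norm_indicatorConstLp two_ne_zero ENNReal.ofNat_ne_top, norm_one, one_mul,
        ENNReal.toReal_ofNat, ← Real.sqrt_eq_rpow, Real.sq_sqrt (by positivity)]
      rfl
    have hint : (∫ t in x..x + p, ‖F t + F (t + p)‖ ^ 2) = ∫ t in u, ‖g t‖ ^ 2 := by
      rw [intervalIntegral.integral_of_le (by linarith), hu, Set.inter_comm,
        ← setIntegral_indicator hs]
      refine setIntegral_congr_fun measurableSet_Ioc fun t ht => ?_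
      have h0 : F (t + p) = 0 := hFs _ fun h => by linarith [ht.1, h.2]
      simp only [h0, add_zero]
      by_cases hts : t ∈ s
      · have htu : t ∈ u := ⟨hts, ht⟩
        simp [hFdef, htu, hts]
      · have htu : t ∉ u := fun h => hts h.1
        simp [hFdef, htu, hts]
    rw [hint, hnf] at hle
    rw [integral_const_mul, setIntegral_const, smul_eq_mul, mul_comm _ B]
    exact hle
  have hall : ∀ᵐ t, ∀ k : ℤ, t ∈ Set.Ioc (k * p) (k * p + p) → p * ‖g t‖ ^ 2 ≤ B :=
    ae_all_iff.2 fun k => hloc (k * p)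
  filter_upwards [hall] with t ht
  obtain ⟨k, hk, -⟩ := existsUnique_add_zsmul_mem_Ioc hp t 0
  refine ht (-k) ?_
  simp only [zsmul_eq_mul, zero_add, Set.mem_Ioc] at hk
  push_cast
  exact ⟨by linarith [hk.1], by linarith [hk.2]⟩

lemma measurable_tsum_of_summable {ι : Type*} [Countable ι] {E : Type*} [NormedAddCommGroup E]
    [MeasurableSpace E] [BorelSpace E] [SecondCountableTopology E] {f : ι → ℝ → E}
    (hf : ∀ i, Measurable (f i)) (hs : ∀ t, Summable fun i => f i t) :
    Measurable fun t => ∑' i, f i t := by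
  refine measurable_of_tendsto_metrizable' atTop
    (f := fun (s : Finset ι) t => ∑ i ∈ s, f i t) (fun s => by fun_prop) ?_
  rw [tendsto_pi_nhds]
  exact fun t => (hs t).hasSum

/-- Periodization of a function supported on two periods, in terms of correlations. -/
lemma integral_norm_add_sq {x y p : ℝ} (hp : 0 < p) (hy : y ≤ x + 2 * p) {F : ℝ → ℂ}
    (hF : MemLp F 2 volume) (hsupp : ∀ t, t ∉ Set.Ico x y → F t = 0) :
    ((∫ t in x..x + p, ‖F t + F (t + p)‖ ^ 2 : ℝ) : ℂ) =
      ∫ t, (((‖F t‖ ^ 2 : ℝ) : ℂ) +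
        ((Set.Ico x (y - p)).indicator (fun t => starRingEnd ℂ (F t) * F (t + p)) t +
        (Set.Ico (x + p) y).indicator (fun t => starRingEnd ℂ (F t) * F (t - p)) t)) := by
  have hFp : MemLp (fun t => F (t + p)) 2 volume :=
    hF.comp_measurePreserving (measurePreserving_add_right volume p)
  have hFm : MemLp (fun t => F (t - p)) 2 volume :=
    hF.comp_measurePreserving (measurePreserving_sub_right volume p)
  have hFc : MemLp (fun t => starRingEnd ℂ (F t)) 2 volume := hF.star
  have hFpc : MemLp (fun t => starRingEnd ℂ (F (t + p))) 2 volume := hFp.star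
  have i1 : Integrable (fun t => ‖F t‖ ^ 2) volume :=
    (memLp_two_iff_integrable_sq_norm hF.aestronglyMeasurable).1 hF
  have i1' : Integrable (fun t => ((‖F t‖ ^ 2 : ℝ) : ℂ)) volume := i1.ofReal
  have i2 : Integrable (fun t => starRingEnd ℂ (F t) * F (t + p)) volume := hFc.integrable_mul hFp
  have i3 : Integrable (fun t => starRingEnd ℂ (F t) * F (t - p)) volume := hFc.integrable_mul hFm
  have i4 : Integrable (fun t => starRingEnd ℂ (F (t + p)) * F t) volume := hFpc.integrable_mul hF
  have i5 : Integrable (fun t => ((‖F (t + p)‖ ^ 2 : ℝ) : ℂ)) volume := i1'.comp_add_right p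
  have hexp : ∀ t, ((‖F t + F (t + p)‖ ^ 2 : ℝ) : ℂ) =
      ((‖F t‖ ^ 2 : ℝ) : ℂ) + ((‖F (t + p)‖ ^ 2 : ℝ) : ℂ) +
        (starRingEnd ℂ (F t) * F (t + p) + starRingEnd ℂ (F (t + p)) * F t) := fun t => by
    simp only [← Complex.normSq_eq_norm_sq, Complex.normSq_eq_conj_mul_self, map_add]
    ring
  rw [← intervalIntegral.integral_ofReal]
  simp only [hexp]
  have i6 : Integrable (fun t =>
      (Set.Ico x (y - p)).indicator (fun t => starRingEnd ℂ (F t) * F (t + p)) t +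
      (Set.Ico (x + p) y).indicator (fun t => starRingEnd ℂ (F t) * F (t - p)) t) volume :=
    (i2.indicator measurableSet_Ico).add (i3.indicator measurableSet_Ico)
  have i7 : Integrable (fun t => ((‖F t‖ ^ 2 : ℝ) : ℂ) + ((‖F (t + p)‖ ^ 2 : ℝ) : ℂ)) volume :=
    i1'.add i5
  have i8 : Integrable (fun t => starRingEnd ℂ (F t) * F (t + p) +
      starRingEnd ℂ (F (t + p)) * F t) volume := i2.add i4
  rw [integral_add i1' i6,
    integral_add (i2.indicator measurableSet_Ico) (i3.indicator measurableSet_Ico),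
    intervalIntegral.integral_add i7.intervalIntegrable i8.intervalIntegrable,
    intervalIntegral.integral_add i1'.intervalIntegrable i5.intervalIntegrable,
    intervalIntegral.integral_add i2.intervalIntegrable i4.intervalIntegrable]
  -- The two square terms glue to the integral over both periods. Of the cross terms, one stays on
  -- the first period and the other is moved by p to the second; the support of F cuts each down to
  -- a cell.
  congr 1
  · rw [intervalIntegral.integral_comp_add_right (fun t => ((‖F t‖ ^ 2 : ℝ) : ℂ)),
      intervalIntegral.integral_add_adjacent_intervals i1'.intervalIntegrable
        i1'.intervalIntegrable, intervalIntegral.integral_of_le (by linarith),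
      ← integral_Ico_eq_integral_Ioc, setIntegral_eq_integral_of_forall_compl_eq_zero]
    intro t ht
    rw [hsupp t fun h => ht ⟨h.1, by linarith [h.2]⟩]
    simp
  congr 1
  · rw [intervalIntegral.integral_of_le (by linarith), ← integral_Ico_eq_integral_Ioc,
      ← integral_indicator measurableSet_Ico]
    congr 1
    funext t
    by_cases h1 : t ∈ Set.Ico x (y - p)
    · rw [Set.indicator_of_mem h1, Set.indicator_of_mem (Set.mem_Ico.2 ⟨h1.1, by linarith [h1.2]⟩)]
    · rw [Set.indicator_of_notMem h1]
      by_cases h2 : t ∈ Set.Ico x (x + p)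
      · have : F (t + p) = 0 := hsupp _ fun h => h1 ⟨h2.1, by linarith [h.2]⟩
        rw [Set.indicator_of_mem h2, this, mul_zero]
      · rw [Set.indicator_of_notMem h2]
  · have := intervalIntegral.integral_comp_add_right (a := x) (b := x + p)
      (fun t => starRingEnd ℂ (F t) * F (t - p)) p
    simp only [add_sub_cancel_right] at this
    rw [this, intervalIntegral.integral_of_le (by linarith), ← integral_Ico_eq_integral_Ioc,
      ← integral_indicator measurableSet_Ico]
    congr 1
    funext t
    by_cases h1 : t ∈ Set.Ico (x + p) y
    · rw [Set.indicator_of_mem h1, Set.indicator_of_mem (Set.mem_Ico.2 ⟨h1.1, by linarith [h1.2]⟩)]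
    · rw [Set.indicator_of_notMem h1]
      by_cases h2 : t ∈ Set.Ico (x + p) (x + p + p)
      · have : F t = 0 := hsupp _ fun h => h1 ⟨h2.1, h.2⟩
        rw [Set.indicator_of_mem h2, this, map_zero, zero_mul]
      · rw [Set.indicator_of_notMem h2]

/-! ### Admissible geometry and the weights of the frame operator. -/

/-- The geometric conditions under which the frame operator couples points only in pairs. -/
structure Admissible (c d p : ℤ → ℝ) : Prop where
  pos : ∀ n, 0 < p n
  len : ∀ n, d n ≤ c n + 2 * p n
  disj : Pairwise (Function.onFun Disjoint (cell c d p))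
  mono : Monotone c
  overlap : ∀ n, d n ≤ c (n + 2)

lemma cell_subset {c d p : ℤ → ℝ} (hp : ∀ n, 0 < p n) (j : ℤ × Bool) :
    cell c d p j ⊆ Set.Ico (c j.1) (d j.1) := by
  rcases j with ⟨n, _ | _⟩ <;> intro t ht <;> simp only [cell, Set.mem_Ico] at ht ⊢ <;>
    have := hp n <;> constructor <;> linarith [ht.1, ht.2]

/-- At each point at most three consecutive windows are non-zero. -/
lemma Admissible.exists_finset {c d p : ℤ → ℝ} (h : Admissible c d p) (t : ℝ) :
    ∃ s : Finset ℤ, s.card ≤ 3 ∧ ∀ n, n ∉ s → t ∉ Set.Ico (c n) (d n) := by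
  have key : ∀ n m, n + 2 ≤ m → t ∈ Set.Ico (c n) (d n) → t ∉ Set.Ico (c m) (d m) :=
    fun n m hnm h1 h2 =>
      absurd (h1.2.trans_le ((h.overlap n).trans (h.mono hnm))) (not_lt.2 h2.1)
  by_cases hk : ∃ k, t ∈ Set.Ico (c k) (d k)
  · obtain ⟨k, hk⟩ := hk
    refine ⟨{k - 1, k, k + 1}, Finset.card_le_three, fun n hn hnt => ?_⟩
    simp only [Finset.mem_insert, Finset.mem_singleton, not_or] at hn
    rcases lt_trichotomy n k with h1 | h1 | h1
    · exact key n k (by omega) hnt hk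
    · exact hn.2.1 h1
    · exact key k n (by omega) hk hnt
  · push Not at hk
    exact ⟨∅, by simp, fun n _ => hk n⟩

section Weights

variable {c d p : ℤ → ℝ} {γ : ℤ → ℝ → ℂ} {B : ℝ}

/-- The summand of the diagonal weight. -/
def diagTerm (p : ℤ → ℝ) (γ : ℤ → ℝ → ℂ) (n : ℤ) (t : ℝ) : ℂ := ((p n * ‖γ n t‖ ^ 2 : ℝ) : ℂ)

/-- The summand of the off-diagonal weight living on a cell. -/
def cellTerm (c d p : ℤ → ℝ) (γ : ℤ → ℝ → ℂ) (j : ℤ × Bool) (t : ℝ) : ℂ :=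
  (cell c d p j).indicator
    (fun t => p j.1 * γ j.1 t * starRingEnd ℂ (γ j.1 (t + shift p j))) t

/-- The diagonal weight `∑ p_n |γ_n|²`. -/
def diagWeight (p : ℤ → ℝ) (γ : ℤ → ℝ → ℂ) (t : ℝ) : ℂ := ∑' n, diagTerm p γ n t

/-- The off-diagonal weight. -/
def offWeight (c d p : ℤ → ℝ) (γ : ℤ → ℝ → ℂ) (t : ℝ) : ℂ :=
  ∑' n, (cellTerm c d p γ (n, false) t + cellTerm c d p γ (n, true) t)

/-- The number of windows that are non-zero at a point. -/
def windowCount (c d : ℤ → ℝ) (t : ℝ) : ℝ :=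
  ∑' n, (Set.Ico (c n) (d n)).indicator (fun _ => (1 : ℝ)) t

lemma hasSum_windowCount (h : Admissible c d p) (t : ℝ) :
    HasSum (fun n => (Set.Ico (c n) (d n)).indicator (fun _ => (1 : ℝ)) t) (windowCount c d t) := by
  obtain ⟨s, -, hs⟩ := h.exists_finset t
  exact (summable_of_ne_finset_zero (s := s) fun n hn => by simp [hs n hn]).hasSum

lemma windowCount_nonneg (c d : ℤ → ℝ) (t : ℝ) : 0 ≤ windowCount c d t :=
  tsum_nonneg fun _ => Set.indicator_nonneg (fun _ _ => zero_le_one) _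

/-- The window indicators serve as summable majorants, both for bounding the diagonal weight and for
the dominated convergence of the quadratic form. -/
lemma windowCount_le (h : Admissible c d p) (t : ℝ) : windowCount c d t ≤ 3 := by
  obtain ⟨s, hc, hs⟩ := h.exists_finset t
  rw [windowCount, tsum_eq_sum (s := s) fun n hn => by simp [hs n hn]]
  calc _ ≤ ∑ _n ∈ s, (1 : ℝ) :=
        Finset.sum_le_sum fun n _ => Set.indicator_le_self' (fun _ _ => zero_le_one) t
    _ ≤ 3 := by simp only [Finset.sum_const, nsmul_eq_mul, mul_one]; exact_mod_cast hc

lemma measurable_windowCount (h : Admissible c d p) : Measurable (windowCount c d) :=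
  measurable_tsum_of_summable (fun _ => measurable_const.indicator measurableSet_Ico)
    fun t => (hasSum_windowCount h t).summable

variable (h : Admissible c d p) (hγm : ∀ n, Measurable (γ n))
  (hγ0 : ∀ n t, t ∉ Set.Ico (c n) (d n) → γ n t = 0) (hγB : ∀ n t, p n * ‖γ n t‖ ^ 2 ≤ B)

include h hγ0 in
lemma hasSum_diagWeight (t : ℝ) : HasSum (fun n => diagTerm p γ n t) (diagWeight p γ t) := by
  obtain ⟨s, -, hs⟩ := h.exists_finset t
  exact (summable_of_ne_finset_zero (s := s) fun n hn => by
    simp [diagTerm, hγ0 n t (hs n hn)]).hasSum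

include h hγ0 hγB in
lemma norm_diagTerm_le (n : ℤ) (t : ℝ) :
    ‖diagTerm p γ n t‖ ≤ (Set.Ico (c n) (d n)).indicator (fun _ => (1 : ℝ)) t * B := by
  by_cases ht : t ∈ Set.Ico (c n) (d n)
  · rw [Set.indicator_of_mem ht, one_mul, diagTerm, Complex.norm_real, Real.norm_of_nonneg]
    · exact hγB n t
    · have := h.pos n
      positivity
  · rw [Set.indicator_of_notMem ht]
    simp [diagTerm, hγ0 n t ht]

include h hγ0 hγB in
lemma norm_diagWeight_le (hB : 0 ≤ B) (t : ℝ) : ‖diagWeight p γ t‖ ≤ 3 * B := by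
  calc ‖diagWeight p γ t‖ ≤ windowCount c d t * B :=
        tsum_of_norm_bounded ((hasSum_windowCount h t).mul_right B)
          fun n => norm_diagTerm_le h hγ0 hγB n t
    _ ≤ 3 * B := by gcongr; exact windowCount_le h t

include h hγ0 hγm in
lemma measurable_diagWeight : Measurable (diagWeight p γ) := by
  refine measurable_tsum_of_summable (fun n => ?_) fun t => (hasSum_diagWeight h hγ0 t).summable
  unfold diagTerm
  fun_prop

lemma conj_diagWeight (t : ℝ) : starRingEnd ℂ (diagWeight p γ t) = diagWeight p γ t := by
  unfold diagWeight diagTerm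
  rw [← Complex.ofReal_tsum, Complex.conj_ofReal]

lemma cellTerm_of_notMem {t : ℝ} {j : ℤ × Bool} (hj : t ∉ cell c d p j) :
    cellTerm c d p γ j t = 0 := Set.indicator_of_notMem hj _

lemma offWeight_of_notMem {t : ℝ} (ht : ∀ j, t ∉ cell c d p j) : offWeight c d p γ t = 0 := by
  simp [offWeight, cellTerm_of_notMem (ht _)]

include h in
-- Disjointness of the cells leaves a single nonzero summand at t.
lemma hasSum_cellTerm_of_mem {t : ℝ} {j : ℤ × Bool} (hj : t ∈ cell c d p j) :
    HasSum (fun n => cellTerm c d p γ (n, false) t + cellTerm c d p γ (n, true) t)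
      (cellTerm c d p γ j t) := by
  have h0 : ∀ i, i ≠ j → cellTerm c d p γ i t = 0 := fun i hi =>
    cellTerm_of_notMem fun hmem => hi (eq_of_mem_cell h.disj hmem hj)
  convert hasSum_single j.1 fun n hn => ?_ using 1
  · rcases j with ⟨n, _ | _⟩
    · rw [h0 (n, true) (by simp), add_zero]
    · rw [h0 (n, false) (by simp), zero_add]
  · rw [h0 (n, false) fun hh => hn (by rw [← hh]), h0 (n, true) fun hh => hn (by rw [← hh]),
      add_zero]

include h in
lemma offWeight_eq_cellTerm {t : ℝ} {j : ℤ × Bool} (hj : t ∈ cell c d p j) :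
    offWeight c d p γ t = cellTerm c d p γ j t := (hasSum_cellTerm_of_mem h hj).tsum_eq

include h in
lemma hasSum_offWeight (t : ℝ) :
    HasSum (fun n => cellTerm c d p γ (n, false) t + cellTerm c d p γ (n, true) t)
      (offWeight c d p γ t) := by
  by_cases ht : ∃ j, t ∈ cell c d p j
  · obtain ⟨j, hj⟩ := ht
    rw [offWeight_eq_cellTerm h hj]
    exact hasSum_cellTerm_of_mem h hj
  · push Not at ht
    rw [offWeight_of_notMem ht]
    simpa only [cellTerm_of_notMem (ht _), add_zero] using hasSum_zero

include hγm in
lemma measurable_cellTerm (j : ℤ × Bool) : Measurable (cellTerm c d p γ j) := by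
  refine Measurable.indicator ?_ (measurableSet_cell c d p j)
  have h1 := hγm j.1
  have h2 : Measurable fun t => γ j.1 (t + shift p j) := h1.comp (measurable_add_const _)
  exact (measurable_const.mul h1).mul (Complex.continuous_conj.measurable.comp h2)

include h hγm in
lemma measurable_offWeight : Measurable (offWeight c d p γ) :=
  measurable_tsum_of_summable
    (fun n => (measurable_cellTerm hγm (n, false)).add (measurable_cellTerm hγm (n, true)))
    fun t => (hasSum_offWeight h t).summable

include h hγB in
lemma norm_cellTerm_le (hB : 0 ≤ B) (j : ℤ × Bool) (t : ℝ) : ‖cellTerm c d p γ j t‖ ≤ B := by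
  by_cases ht : t ∈ cell c d p j
  · rw [cellTerm, Set.indicator_of_mem ht]
    have h1 := hγB j.1 t
    have h2 := hγB j.1 (t + shift p j)
    have h3 := h.pos j.1
    simp only [norm_mul, RCLike.norm_conj, Complex.norm_real, Real.norm_of_nonneg h3.le]
    -- The arithmetic-geometric mean inequality bounds the product by the mean of two terms, each at
    -- most B.
    nlinarith [mul_nonneg h3.le (sq_nonneg (‖γ j.1 t‖ - ‖γ j.1 (t + shift p j)‖))]
  · rw [cellTerm_of_notMem ht, norm_zero]
    exact hB

include h hγB in
lemma norm_cellTerm_le_indicator (hB : 0 ≤ B) (j : ℤ × Bool) (t : ℝ) :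
    ‖cellTerm c d p γ j t‖ ≤ (Set.Ico (c j.1) (d j.1)).indicator (fun _ => (1 : ℝ)) t * B := by
  by_cases ht : t ∈ Set.Ico (c j.1) (d j.1)
  · rw [Set.indicator_of_mem ht, one_mul]
    exact norm_cellTerm_le h hγB hB j t
  · rw [cellTerm_of_notMem fun hj => ht (cell_subset h.pos j hj), Set.indicator_of_notMem ht]
    simp

include h hγB in
lemma norm_offWeight_le (hB : 0 ≤ B) (t : ℝ) : ‖offWeight c d p γ t‖ ≤ B := by
  by_cases ht : ∃ j, t ∈ cell c d p j
  · obtain ⟨j, hj⟩ := ht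
    rw [offWeight_eq_cellTerm h hj]
    exact norm_cellTerm_le h hγB hB j t
  · push Not at ht
    rw [offWeight_of_notMem ht, norm_zero]
    exact hB

include h in
-- Passing to the partner point interchanges the two window values, only one of which is conjugated.
-- This is the hermitian symmetry of the 2×2 matrices.
lemma offWeight_swap (t : ℝ) :
    offWeight c d p γ (swap c d p t) = starRingEnd ℂ (offWeight c d p γ t) := by
  by_cases ht : ∃ j, t ∈ cell c d p j
  · obtain ⟨j, hj⟩ := ht
    have hj' := swap_mem_cell h.disj hj
    rw [offWeight_eq_cellTerm h hj, offWeight_eq_cellTerm h hj', cellTerm, cellTerm,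
      Set.indicator_of_mem hj, Set.indicator_of_mem hj', swap_of_mem h.disj hj, shift_partner]
    simp only [map_mul, Complex.conj_ofReal, Complex.conj_conj, add_neg_cancel_right]
    simp only [partner]
    ring
  · push Not at ht
    rw [swap_of_notMem ht, offWeight_of_notMem ht, map_zero]

open Classical in
/-- The sign that distinguishes a cell from its partner. -/
def cellSign (c d p : ℤ → ℝ) (t : ℝ) : ℂ := if t ∈ ⋃ n, cell c d p (n, true) then -1 else 1

lemma measurable_cellSign : Measurable (cellSign c d p) :=
  Measurable.ite (.iUnion fun n => measurableSet_cell c d p (n, true)) measurable_const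
    measurable_const

lemma cellSign_eq (t : ℝ) : cellSign c d p t = 1 ∨ cellSign c d p t = -1 := by
  unfold cellSign
  split_ifs <;> simp

include h in
lemma cellSign_swap {t : ℝ} (ht : offWeight c d p γ t ≠ 0) :
    cellSign c d p (swap c d p t) = -cellSign c d p t := by
  by_cases hex : ∃ j, t ∈ cell c d p j
  · obtain ⟨⟨n, _ | _⟩, hj⟩ := hex
    · have h1 : t ∉ ⋃ n, cell c d p (n, true) := fun hh => by
        obtain ⟨m, hm⟩ := Set.mem_iUnion.1 hh
        simpa using eq_of_mem_cell h.disj hj hm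
      have h2 : swap c d p t ∈ ⋃ n, cell c d p (n, true) :=
        Set.mem_iUnion.2 ⟨n, swap_mem_cell h.disj hj⟩
      rw [cellSign, if_pos h2, cellSign, if_neg h1]
    · have h1 : t ∈ ⋃ n, cell c d p (n, true) := Set.mem_iUnion.2 ⟨n, hj⟩
      have h2 : swap c d p t ∉ ⋃ n, cell c d p (n, true) := fun hh => by
        obtain ⟨m, hm⟩ := Set.mem_iUnion.1 hh
        simpa [partner] using eq_of_mem_cell h.disj (swap_mem_cell h.disj hj) hm
      rw [cellSign, if_neg h2, cellSign, if_pos h1, neg_neg]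
  · push Not at hex
    exact absurd (offWeight_of_notMem hex) ht

end Weights

/-! ### The quadratic form of the frame operator. -/

section Form

variable {c d p : ℤ → ℝ} {γ : ℤ → ℝ → ℂ} {B : ℝ}
variable (h : Admissible c d p) (hγm : ∀ n, Measurable (γ n))
  (hγ0 : ∀ n t, t ∉ Set.Ico (c n) (d n) → γ n t = 0) (hγB : ∀ n t, p n * ‖γ n t‖ ^ 2 ≤ B)

/-- The contribution of the `n`-th window to the quadratic form of the frame operator. -/
def formTerm (c d p : ℤ → ℝ) (γ : ℤ → ℝ → ℂ) (f : ℝ → ℂ) (n : ℤ) (t : ℝ) : ℂ :=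
  starRingEnd ℂ (f t) * (diagTerm p γ n t * f t +
    (cellTerm c d p γ (n, false) t + cellTerm c d p γ (n, true) t) * f (swap c d p t))

include h hγm hγB in
lemma memLp_conj_window_mul (n : ℤ) (f : L2) :
    MemLp (fun t => starRingEnd ℂ (γ n t) * f t) 2 volume := by
  have hp := h.pos n
  have hb : MemLp (fun t => starRingEnd ℂ (γ n t)) ∞ volume := by
    refine memLp_top_of_bound
      (Complex.continuous_conj.measurable.comp (hγm n)).aestronglyMeasurable (1 + B / p n)
      (Eventually.of_forall fun t => ?_)
    have h1 : ‖γ n t‖ ^ 2 ≤ B / p n := by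
      rw [le_div_iff₀ hp, mul_comm]
      exact hγB n t
    rw [RCLike.norm_conj]
    nlinarith [sq_nonneg (‖γ n t‖ - 1)]
  exact (Lp.memLp f).mul hb

include h hγm hγ0 hγB in
-- The right-hand side is the Parseval value for conj(γ_n) f. Its cross terms sit on the two cells
-- of the n-th window, where translation by ±p_n agrees with `swap`.
lemma integral_formTerm (n : ℤ) (f : L2) :
    ∫ t, formTerm c d p γ f n t =
      ((p n * ∫ t in c n..c n + p n, ‖starRingEnd ℂ (γ n t) * f t +
        starRingEnd ℂ (γ n (t + p n)) * f (t + p n)‖ ^ 2 : ℝ) : ℂ) := by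
  have h1 := integral_norm_add_sq (h.pos n) (h.len n) (memLp_conj_window_mul h hγm hγB n f)
    fun t ht => by simp [hγ0 n t ht]
  rw [Complex.ofReal_mul, h1, ← integral_const_mul]
  refine integral_congr_ae (Eventually.of_forall fun t => ?_)
  have hdiag : starRingEnd ℂ (f t) * (diagTerm p γ n t * f t) =
      p n * ((‖starRingEnd ℂ (γ n t) * f t‖ ^ 2 : ℝ) : ℂ) := by
    simp only [diagTerm, norm_mul, RCLike.norm_conj, mul_pow, Complex.ofReal_mul]
    simp only [← Complex.normSq_eq_norm_sq, Complex.normSq_eq_conj_mul_self]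
    ring
  have hleft : starRingEnd ℂ (f t) * (cellTerm c d p γ (n, false) t * f (swap c d p t)) =
      p n * (Set.Ico (c n) (d n - p n)).indicator (fun t =>
        starRingEnd ℂ (starRingEnd ℂ (γ n t) * f t) *
          (starRingEnd ℂ (γ n (t + p n)) * f (t + p n))) t := by
    by_cases ht : t ∈ cell c d p (n, false)
    · rw [cellTerm, Set.indicator_of_mem ht, swap_of_mem h.disj ht,
        Set.indicator_of_mem (show t ∈ Set.Ico (c n) (d n - p n) from ht)]
      simp only [shift, map_mul, Complex.conj_conj]
      ring
    · rw [cellTerm_of_notMem ht,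
        Set.indicator_of_notMem (show t ∉ Set.Ico (c n) (d n - p n) from ht)]
      ring
  have hright : starRingEnd ℂ (f t) * (cellTerm c d p γ (n, true) t * f (swap c d p t)) =
      p n * (Set.Ico (c n + p n) (d n)).indicator (fun t =>
        starRingEnd ℂ (starRingEnd ℂ (γ n t) * f t) *
          (starRingEnd ℂ (γ n (t - p n)) * f (t - p n))) t := by
    by_cases ht : t ∈ cell c d p (n, true)
    · rw [cellTerm, Set.indicator_of_mem ht, swap_of_mem h.disj ht,
        Set.indicator_of_mem (show t ∈ Set.Ico (c n + p n) (d n) from ht)]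
      simp only [shift, map_mul, Complex.conj_conj, ← sub_eq_add_neg]
      ring
    · rw [cellTerm_of_notMem ht,
        Set.indicator_of_notMem (show t ∉ Set.Ico (c n + p n) (d n) from ht)]
      ring
  simp only [formTerm]
  linear_combination hdiag + hleft + hright

include h hγm hγ0 hγB in
lemma hasSum_integral_formTerm (hB : 0 ≤ B) (f : L2) :
    HasSum (fun n => ∫ t, formTerm c d p γ f n t)
      (∫ t, starRingEnd ℂ (f t) *
        (diagWeight p γ t * f t + offWeight c d p γ t * f (swap c d p t))) := by
  have hfs : MemLp (fun t => f (swap c d p t)) 2 volume :=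
    (Lp.memLp f).comp_measurePreserving (measurePreserving_swap h.disj)
  -- The n-th term is dominated by H times the indicator of its window, with 2B accounting for the
  -- two cells. The majorants sum to at most 3H, which is integrable because f and f ∘ `swap` are in
  -- L².
  set H : ℝ → ℝ := fun t => B * (‖f t‖ * ‖f t‖) + 2 * B * (‖f t‖ * ‖f (swap c d p t)‖) with hH
  have hHi : Integrable H volume :=
    (((Lp.memLp f).norm.integrable_mul (Lp.memLp f).norm).const_mul B).add
      (((Lp.memLp f).norm.integrable_mul hfs.norm).const_mul (2 * B))
  have hdiag : ∀ n, Measurable (diagTerm p γ n) := fun n => by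
    unfold diagTerm
    fun_prop
  refine hasSum_integral_of_dominated_convergence
    (fun n t => (Set.Ico (c n) (d n)).indicator (fun _ => (1 : ℝ)) t * H t) (fun n => ?_)
    (fun n => Eventually.of_forall fun t => ?_)
    (Eventually.of_forall fun t => ((hasSum_windowCount h t).mul_right (H t)).summable) ?_
    (Eventually.of_forall fun t => ?_)
  · exact (Lp.memLp f).star.aestronglyMeasurable.mul
      (((hdiag n).aestronglyMeasurable.mul (Lp.aestronglyMeasurable f)).add
        (((measurable_cellTerm hγm _).add (measurable_cellTerm hγm _)).aestronglyMeasurable.mul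
          hfs.aestronglyMeasurable))
  · have h1 := norm_diagTerm_le h hγ0 hγB n t
    have h2 := norm_cellTerm_le_indicator h hγB hB (n, false) t
    have h3 := norm_cellTerm_le_indicator h hγB hB (n, true) t
    set χ := (Set.Ico (c n) (d n)).indicator (fun _ => (1 : ℝ)) t
    calc ‖formTerm c d p γ f n t‖
        ≤ ‖f t‖ * (‖diagTerm p γ n t‖ * ‖f t‖ + (‖cellTerm c d p γ (n, false) t‖ +
            ‖cellTerm c d p γ (n, true) t‖) * ‖f (swap c d p t)‖) := by
          rw [formTerm, norm_mul, RCLike.norm_conj]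
          gcongr
          refine (norm_add_le _ _).trans ?_
          rw [norm_mul, norm_mul]
          gcongr
          exact norm_add_le _ _
      _ ≤ ‖f t‖ * (χ * B * ‖f t‖ + (χ * B + χ * B) * ‖f (swap c d p t)‖) := by gcongr
      _ = χ * H t := by simp only [hH]; ring
  · have htsum : (fun t => ∑' n, (Set.Ico (c n) (d n)).indicator (fun _ => (1 : ℝ)) t * H t) =
        fun t => windowCount c d t * H t := by
      funext t
      exact ((hasSum_windowCount h t).mul_right (H t)).tsum_eq
    rw [htsum]
    refine hHi.bdd_mul (c := 3) (measurable_windowCount h).aestronglyMeasurable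
      (Eventually.of_forall fun t => ?_)
    rw [Real.norm_of_nonneg (windowCount_nonneg c d t)]
    exact windowCount_le h t
  · exact (((hasSum_diagWeight h hγ0 t).mul_right _).add
      ((hasSum_offWeight h t).mul_right _)).mul_left _

end Form

/-- Under the geometric conditions, the frame operator and its inverse are of the form
`f ↦ D f + W (f ∘ swap)` with `W` supported on the cells. -/
theorem exists_frameOperator_eq_swapOp {c d b : ℤ → ℝ} {g : ℤ → L2}
    (h : Admissible c d fun n => (b n)⁻¹)
    (hg : ∀ n, ∀ᵐ t, t ∉ Set.Icc (c n) (d n) → g n t = 0) (hframe : IsFrame (nsgSystem g b)) :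
    ∃ S : L2 ≃L[ℂ] L2, IsFrameOperator (nsgSystem g b) S ∧
      ∃ (D W D' W' : ℝ → ℂ) (hD : MemLp D ∞ volume) (hW : MemLp W ∞ volume)
        (hD' : MemLp D' ∞ volume) (hW' : MemLp W' ∞ volume),
        (∀ t, (∀ j, t ∉ cell c d (fun n => (b n)⁻¹) j) → W t = 0 ∧ W' t = 0) ∧
        (∀ f, S f = swapOp (measurePreserving_swap h.disj) (hD.toLp D) (hW.toLp W) f) ∧
        (∀ f, S.symm f = swapOp (measurePreserving_swap h.disj) (hD'.toLp D') (hW'.toLp W') f) := by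
  obtain ⟨S, hS, hSq, A, hA, hlow⟩ := exists_frameOperator hframe
  obtain ⟨A₀, B, hA₀, hAB, hf⟩ := hframe
  have hB : 0 ≤ B := hA₀.le.trans hAB
  set p : ℤ → ℝ := fun n => (b n)⁻¹ with hp
  have hbound : ∀ n, ∀ᵐ t, p n * ‖g n t‖ ^ 2 ≤ B := fun n => by
    refine mul_norm_sq_le_of_bessel (h.pos n) (g n) fun f a ha => ?_
    simp only [hp, inv_inv] at ha
    refine le_trans ?_ (hf f).2.2
    rw [← ha.tsum_eq]
    exact tsum_comp_le_tsum_of_inj (hf f).1 (fun _ => by positivity)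
      (i := fun m : ℤ => ((m, n) : ℤ × ℤ)) fun x y hxy => by simpa using hxy
  -- Truncating the windows on a null set makes the support condition and the bound hold at every
  -- point.
  set u : ℤ → Set ℝ := fun n => Set.Ico (c n) (d n) ∩ {t | p n * ‖g n t‖ ^ 2 ≤ B} with hu
  have hgm : ∀ n, Measurable (g n) := fun n => (Lp.stronglyMeasurable (g n)).measurable
  have hum : ∀ n, MeasurableSet (u n) := fun n =>
    measurableSet_Ico.inter (measurableSet_le (by have := hgm n; fun_prop) measurable_const)
  set γ : ℤ → ℝ → ℂ := fun n => (u n).indicator (g n) with hγ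
  have hγm : ∀ n, Measurable (γ n) := fun n => (hgm n).indicator (hum n)
  have hγ0 : ∀ n t, t ∉ Set.Ico (c n) (d n) → γ n t = 0 := fun n t ht =>
    Set.indicator_of_notMem (fun hh => ht hh.1) _
  have hγB : ∀ n t, p n * ‖γ n t‖ ^ 2 ≤ B := fun n t => by
    by_cases ht : t ∈ u n
    · simp only [hγ, Set.indicator_of_mem ht]
      exact ht.2
    · simpa only [hγ, Set.indicator_of_notMem ht, norm_zero, ne_eq, OfNat.ofNat_ne_zero,
        not_false_eq_true, zero_pow, mul_zero] using hB
  have hγg : ∀ n, ∀ᵐ t, γ n t = g n t := fun n => by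
    have hne : ∀ᵐ t : ℝ, t ≠ d n := by simp [ae_iff]
    filter_upwards [hbound n, hg n, hne] with t h1 h2 h3
    by_cases ht : t ∈ Set.Ico (c n) (d n)
    · exact Set.indicator_of_mem (show t ∈ u n from ⟨ht, h1⟩) _
    · rw [hγ0 n t ht, h2 fun hh => ht ⟨hh.1, lt_of_le_of_ne hh.2 h3⟩]
  have hD : MemLp (diagWeight p γ) ∞ volume :=
    memLp_top_of_bound (measurable_diagWeight h hγm hγ0).aestronglyMeasurable (3 * B)
      (Eventually.of_forall (norm_diagWeight_le h hγ0 hγB hB))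
  have hW : MemLp (offWeight c d p γ) ∞ volume :=
    memLp_top_of_bound (measurable_offWeight h hγm).aestronglyMeasurable B
      (Eventually.of_forall (norm_offWeight_le h hγB hB))
  set T := swapOp (measurePreserving_swap h.disj) (hD.toLp _) (hW.toLp _) with hT
  -- The frame sum is evaluated first over the modulations m by Parseval, then over the windows n.
  have hform : ∀ f, (inner ℂ f (S f) : ℂ) = inner ℂ f (T f) := fun f => by
    have hsum := ((Equiv.prodComm ℤ ℤ).hasSum_iff.2 (hSq f))
    have hcoef : ∀ n, HasSum (fun m : ℤ => ((‖inner ℂ (nsgSystem g b (m, n)) f‖ ^ 2 : ℝ) : ℂ))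
        (∫ t, formTerm c d p γ f n t) := fun n => by
      rw [integral_formTerm h hγm hγ0 hγB]
      refine Complex.hasSum_ofReal.2 ?_
      refine (hasSum_sq_fourier_of_support (h.pos n) (memLp_conj_window_mul h hγm hγB n f)
        fun t ht => ?_).congr_fun fun m => ?_
      · rw [hγ0 n t fun hh => ht ⟨hh.1, hh.2.trans_le (h.len n)⟩]
        simp
      · rw [nsgSystem, inner_modulate]
        congr 2
        refine integral_congr_ae ?_
        filter_upwards [hγg n] with t ht
        simp only [ht, hp, inv_inv]
    have h1 := hsum.prod_fiberwise hcoef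
    rw [h1.unique (hasSum_integral_formTerm h hγm hγ0 hγB hB f), L2.inner_def]
    refine integral_congr_ae ?_
    filter_upwards [coeFn_swapOp_toLp (measurePreserving_swap h.disj) hD hW f] with t ht
    rw [hT, ht, RCLike.inner_apply, mul_comm]
  -- Over ℂ an operator is determined by its quadratic form.
  have hST : ∀ f, S f = T f := fun f => by
    have := (ext_inner_map (S : L2 →L[ℂ] L2).toLinearMap T.toLinearMap).1 fun x => by
      rw [← inner_conj_symm]
      conv_rhs => rw [← inner_conj_symm]
      exact congrArg _ (hform x)
    exact LinearMap.congr_fun this f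
  obtain ⟨D', W', hD', hW', hW0, hinv⟩ := exists_swapOp_inverse (measurePreserving_swap h.disj)
    (swap_swap h.disj) hD hW conj_diagWeight (offWeight_swap h) measurable_cellSign cellSign_eq
    (fun t ht => cellSign_swap h ht) hA fun f => by rw [← hT, ← hST]; exact hlow f
  refine ⟨S, hS, _, _, D', W', hD, hW, hD', hW', fun t ht => ?_, hST, fun f => ?_⟩
  · exact ⟨offWeight_of_notMem ht, hW0 t (offWeight_of_notMem ht)⟩
  · rw [ContinuousLinearEquiv.symm_apply_eq, hST, hT, hinv]

/-! ### Essential supports, disjoint sums and Walnut representations. -/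

/-- By the Lindelöf property countably many of the open sets in the definition suffice, so their
exceptional null sets unite to a null set. -/
lemma ae_eq_zero_of_essSupport_subset {f : ℝ → ℂ} {K : Set ℝ} (h : essSupport f ⊆ K) :
    ∀ᵐ t ∂(volume : Measure ℝ), t ∉ K → f t = 0 := by
  obtain ⟨T, hTc, hTS, hT⟩ := TopologicalSpace.isOpen_sUnion_countable
    {U : Set ℝ | IsOpen U ∧ ∀ᵐ t ∂(volume : Measure ℝ), t ∈ U → f t = 0} fun U hU => hU.1
  have hall : ∀ᵐ t ∂(volume : Measure ℝ), ∀ U ∈ T, t ∈ U → f t = 0 :=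
    (ae_ball_iff hTc).2 fun U hU => (hTS hU).2
  filter_upwards [hall] with t ht htK
  have h1 : t ∉ essSupport f := fun hh => htK (h hh)
  rw [essSupport, Set.notMem_compl_iff, ← hT] at h1
  obtain ⟨U, hU, htU⟩ := h1
  exact ht U hU htU

lemma essSupport_subset {f : ℝ → ℂ} {K : Set ℝ} (hK : IsClosed K)
    (h : ∀ᵐ t ∂(volume : Measure ℝ), t ∉ K → f t = 0) : essSupport f ⊆ K :=
  Set.compl_subset_comm.1 (Set.subset_sUnion_of_mem ⟨hK.isOpen_compl, h⟩)

/-- A square integrable function is the unconditional sum of its restrictions to disjoint sets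
that carry it. -/
lemma hasSum_of_disjoint {ι : Type*} [Countable ι] {A : ι → Set ℝ}
    (hA : Pairwise (Function.onFun Disjoint A)) {F : L2} {v : ι → L2}
    (hF : ∀ᵐ t, (∀ i, t ∉ A i) → F t = 0)
    (hv : ∀ i, ∀ᵐ t, v i t = (A i).indicator F t) : HasSum v F := by
  have hsum : ∀ s : Finset ι, ∀ᵐ t, (∑ i ∈ s, v i) t = ∑ i ∈ s, (A i).indicator F t := fun s => by
    filter_upwards [Lp.coeFn_finsetSum s v, ae_all_iff.2 hv] with t h1 h2
    rw [h1, Finset.sum_apply]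
    exact Finset.sum_congr rfl fun i _ => h2 i
  have hval : ∀ (s : Finset ι) (t : ℝ) (i : ι), i ∈ s → t ∈ A i →
      ∑ i ∈ s, (A i).indicator F t = F t := fun s t i hi ht => by
    rw [Finset.sum_eq_single_of_mem i hi fun j _ hj =>
      Set.indicator_of_notMem (fun htj => Set.disjoint_left.1 (hA hj) htj ht) _,
      Set.indicator_of_mem ht]
  have hzero : ∀ (s : Finset ι) (t : ℝ), (∀ i ∈ s, t ∉ A i) →
      ∑ i ∈ s, (A i).indicator F t = 0 := fun s t ht =>
    Finset.sum_eq_zero fun i hi => Set.indicator_of_notMem (ht i hi) _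
  have hsub : ∀ s : Finset ι, ∀ᵐ t, (∑ i ∈ s, v i - F) t =
      ∑ i ∈ s, (A i).indicator F t - F t := fun s => by
    filter_upwards [Lp.coeFn_sub (∑ i ∈ s, v i) F, hsum s] with t h1 h2
    rw [h1, Pi.sub_apply, h2]
  -- At almost every point the error is F or 0, hence dominated by F, and it vanishes once s
  -- contains the index of the set through that point.
  have hlim : Tendsto (fun s : Finset ι => ∫⁻ t, ‖(∑ i ∈ s, v i - F) t‖ₑ ^ 2) atTop
      (𝓝 (∫⁻ _ : ℝ, 0)) := by
    refine tendsto_lintegral_filter_of_dominated_convergence (fun t => ‖F t‖ₑ ^ 2)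
      (Eventually.of_forall fun s => ?_) (Eventually.of_forall fun s => ?_) ?_ ?_
    · have := (Lp.stronglyMeasurable (∑ i ∈ s, v i - F)).measurable
      fun_prop
    · filter_upwards [hsub s] with t ht
      rw [ht]
      by_cases hex : ∃ i ∈ s, t ∈ A i
      · obtain ⟨i, hi, hti⟩ := hex
        rw [hval s t i hi hti]
        simp
      · push Not at hex
        rw [hzero s t hex, zero_sub, enorm_neg]
    · rw [← enorm_sq_eq_lintegral]
      exact ENNReal.pow_ne_top enorm_ne_top
    · filter_upwards [hF, ae_all_iff.2 hsub] with t h1 h2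
      refine tendsto_const_nhds.congr' ?_
      by_cases hex : ∃ i, t ∈ A i
      · obtain ⟨i, hi⟩ := hex
        filter_upwards [eventually_ge_atTop {i}] with s hs
        rw [h2 s, hval s t i (hs (Finset.mem_singleton_self i)) hi]
        simp
      · push Not at hex
        refine Eventually.of_forall fun s => ?_
        beta_reduce
        rw [h2 s, hzero s t fun i _ => hex i, h1 hex]
        simp
  rw [HasSum, SummationFilter.unconditional_filter, tendsto_iff_norm_sub_tendsto_zero]
  simp only [← enorm_sq_eq_lintegral, lintegral_zero] at hlim
  have h3 := (ENNReal.tendsto_toReal ENNReal.zero_ne_top).comp hlim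
  simp only [Function.comp_def, ENNReal.toReal_pow, toReal_enorm, ENNReal.toReal_zero] at h3
  have h4 := (Real.continuous_sqrt.tendsto 0).comp h3
  simp only [Function.comp_def, Real.sqrt_sq (norm_nonneg _), Real.sqrt_zero] at h4
  exact h4

lemma hasSum_option_elim {ι E : Type*} [NormedAddCommGroup E] {g : ι → E} {a : E} (x : E)
    (h : HasSum g a) : HasSum (fun o : Option ι => o.elim x g) (x + a) := by
  have h1 : HasSum (fun o : Option ι => o.elim (0 : E) g) a := by
    refine ((Option.some_injective ι).hasSum_iff fun o ho => ?_).1 h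
    cases o with
    | none => rfl
    | some i => exact absurd ⟨i, rfl⟩ ho
  have h2 : HasSum (fun o : Option ι => o.elim x fun _ => (0 : E)) x :=
    hasSum_single (f := fun o : Option ι => o.elim x fun _ => (0 : E)) none fun o ho => by
      cases o with
      | none => exact absurd rfl ho
      | some i => rfl
  refine (h2.add h1).congr_fun fun o => ?_
  cases o <;> simp

lemma weightMul_translate_zero (w : Linf) (f : L2) :
    weightMul w (translate 0 f) = weightMul w f := by
  have : translate 0 f = f := by
    apply Lp.ext
    filter_upwards [coeFn_translate 0 f] with t ht
    rw [ht, sub_zero]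
  rw [this]

section Representation

variable {c d p : ℤ → ℝ} (hP : Pairwise (Function.onFun Disjoint (cell c d p)))
  {D W : ℝ → ℂ} (hD : MemLp D ∞ volume) (hW : MemLp W ∞ volume)

include hW in
lemma memLp_indicator_cell (j : ℤ × Bool) : MemLp ((cell c d p j).indicator W) ∞ volume :=
  hW.indicator (measurableSet_cell c d p j)

lemma weightMul_swap_apply (f : L2) :
    ∀ᵐ t, weightMul (hW.toLp W) (Lp.compMeasurePreserving _ (measurePreserving_swap hP) f) t =
      W t * f (swap c d p t) := by
  filter_upwards [coeFn_weightMul (hW.toLp W)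
    (Lp.compMeasurePreserving _ (measurePreserving_swap hP) f), hW.coeFn_toLp,
    Lp.coeFn_compMeasurePreserving f (measurePreserving_swap hP)] with t h1 h2 h3
  rw [h1, h2, h3, Function.comp_apply]

/-- On a set on which `swap` is a translation, the weighted composition with `swap` is a
weighted translate. -/
lemma weightMul_translate_indicator {u : Set ℝ} (hu : MemLp (u.indicator W) ∞ volume) {x : ℝ}
    (hux : ∀ t ∈ u, swap c d p t = t - x) (f : L2) :
    ∀ᵐ t, weightMul (hu.toLp _) (translate x f) t =
      u.indicator (weightMul (hW.toLp W)
        (Lp.compMeasurePreserving _ (measurePreserving_swap hP) f)) t := by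
  filter_upwards [weightMul_swap_apply hP hW f, coeFn_weightMul (hu.toLp _) (translate x f),
    hu.coeFn_toLp, coeFn_translate x f] with t h1 h2 h3 h4
  rw [h2, h3, h4]
  by_cases ht : t ∈ u
  · rw [Set.indicator_of_mem ht, Set.indicator_of_mem ht, h1, hux t ht]
  · rw [Set.indicator_of_notMem ht, Set.indicator_of_notMem ht, zero_mul]

lemma weightMul_swap_eq_zero (hW0 : ∀ t, (∀ j, t ∉ cell c d p j) → W t = 0) (f : L2) :
    ∀ᵐ t, (∀ j, t ∉ cell c d p j) →
      weightMul (hW.toLp W) (Lp.compMeasurePreserving _ (measurePreserving_swap hP) f) t = 0 := by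
  filter_upwards [weightMul_swap_apply hP hW f] with t h1 h2
  rw [h1, hW0 t h2, zero_mul]

end Representation

/-- An operator `f ↦ D f + W (f ∘ swap)` has a tridiagonal Walnut representation. -/
theorem hasTridiagonalWalnut_of_eq_swapOp {c d b : ℤ → ℝ}
    (hP : Pairwise (Function.onFun Disjoint (cell c d fun n => (b n)⁻¹)))
    {D W : ℝ → ℂ} (hD : MemLp D ∞ volume) (hW : MemLp W ∞ volume)
    (hW0 : ∀ t, (∀ j, t ∉ cell c d (fun n => (b n)⁻¹) j) → W t = 0) {T : L2 →L[ℂ] L2}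
    (hT : ∀ f, T f = swapOp (measurePreserving_swap hP) (hD.toLp D) (hW.toLp W) f) :
    HasTridiagonalWalnut c d b T := by
  have hcell : ∀ j, MemLp ((cell c d (fun n => (b n)⁻¹) j).indicator W) ∞ volume :=
    memLp_indicator_cell hW
  -- The index k = 1 selects the left cell, where `swap` adds 1/b_n; k = -1 selects the right cell,
  -- where it subtracts 1/b_n.
  refine ⟨hD.toLp D, fun n k => (hcell (n, decide (k = -1))).toLp _,
    fun f => ?_, fun n => ⟨?_, ?_⟩⟩
  · set F := weightMul (hW.toLp W) (Lp.compMeasurePreserving _ (measurePreserving_swap hP) f)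
    have hTf : T f = weightMul (hD.toLp D) f + F := hT f
    have hinj : Function.Injective fun q : ℤ × ({-1, 1} : Set ℤ) =>
        ((q.1, decide ((q.2 : ℤ) = -1)) : ℤ × Bool) := by
      rintro ⟨n, k, rfl | rfl⟩ ⟨m, l, rfl | rfl⟩ hh <;> simp_all
    have hsum : HasSum (fun q : ℤ × ({-1, 1} : Set ℤ) =>
        weightMul ((hcell (q.1, decide ((q.2 : ℤ) = -1))).toLp _)
          (translate (translationConst b q.1 q.2) f)) F := by
      refine hasSum_of_disjoint (hP.comp_of_injective hinj) ?_ fun q => ?_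
      · filter_upwards [weightMul_swap_eq_zero hP hW hW0 f] with t ht htq
        refine ht fun j hj => ?_
        rcases j with ⟨n, _ | _⟩
        · exact htq (n, ⟨1, Or.inr rfl⟩) hj
        · exact htq (n, ⟨-1, Or.inl rfl⟩) hj
      · refine weightMul_translate_indicator hP hW _ (fun t ht => ?_) f
        rw [swap_of_mem hP ht]
        rcases q with ⟨n, k, rfl | rfl⟩ <;> simp [shift, translationConst, Bplus, Bminus] <;> ring
    rw [hTf]
    refine (hasSum_option_elim (weightMul (hD.toLp D) f) hsum).congr_fun fun o => ?_
    cases o with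
    | none => exact weightMul_translate_zero _ _
    | some q => rfl
  · refine essSupport_subset isClosed_Icc ?_
    filter_upwards [(hcell (n, decide ((1 : ℤ) = -1))).coeFn_toLp] with t h1 h2
    rw [h1]
    refine Set.indicator_of_notMem (fun hh => h2 ?_) _
    have hh' : t ∈ Set.Ico (c n) (d n - (b n)⁻¹) := hh
    have : t ∈ Set.Icc (c n) (d n - (b n)⁻¹) := ⟨hh'.1, hh'.2.le⟩
    simpa [Iminus, Bplus] using this
  · refine essSupport_subset isClosed_Icc ?_
    filter_upwards [(hcell (n, decide ((-1 : ℤ) = -1))).coeFn_toLp] with t h1 h2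
    rw [h1]
    refine Set.indicator_of_notMem (fun hh => h2 ?_) _
    have hh' : t ∈ Set.Ico (c n + (b n)⁻¹) (d n) := hh
    have : t ∈ Set.Icc (c n + (b n)⁻¹) (d n) := ⟨hh'.1, hh'.2.le⟩
    simpa [Iplus, Bminus] using this

/-- In the case of a constant modulation parameter and equally spaced windows, the operator
`f ↦ D f + W (f ∘ swap)` is the sum of three weighted translations. -/
theorem hasTridiagonalGaborWalnut_of_eq_swapOp {a b c d : ℝ}
    (hP : Pairwise (Function.onFun Disjoint
      (cell (fun n => c + n * a) (fun n => d + n * a) fun _ => b⁻¹)))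
    {D W : ℝ → ℂ} (hD : MemLp D ∞ volume) (hW : MemLp W ∞ volume)
    (hW0 : ∀ t, (∀ j, t ∉ cell (fun n : ℤ => c + n * a) (fun n => d + n * a) (fun _ => b⁻¹) j) →
      W t = 0) {T : L2 →L[ℂ] L2}
    (hT : ∀ f, T f = swapOp (measurePreserving_swap hP) (hD.toLp D) (hW.toLp W) f) :
    HasTridiagonalGaborWalnut c d a b T := by
  set C := cell (fun n : ℤ => c + n * a) (fun n => d + n * a) fun _ => b⁻¹ with hC
  -- With a constant b, `swap` is one and the same translation on all left cells, and its inverse on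
  -- all right cells, so two off-diagonal weights suffice.
  set u : Bool → Set ℝ := fun s => ⋃ n : ℤ, C (n, s) with hu
  have hum : ∀ s, MemLp ((u s).indicator W) ∞ volume := fun s =>
    hW.indicator (.iUnion fun n => measurableSet_cell _ _ _ _)
  refine ⟨fun k => if k = 0 then hD.toLp D else (hum (decide (k = -1))).toLp _, fun f => ?_, ?_, ?_⟩
  · set F := weightMul (hW.toLp W) (Lp.compMeasurePreserving _ (measurePreserving_swap hP) f)
    have hTf : T f = weightMul (hD.toLp D) f + F := hT f
    have hdisj : Pairwise (Function.onFun Disjoint u) := fun s s' hs => by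
      simp only [Function.onFun, hu, Set.disjoint_iUnion_left, Set.disjoint_iUnion_right]
      exact fun n m => hP fun hh => hs (by simpa using congrArg Prod.snd hh)
    have hsum : HasSum (fun s : Bool => weightMul ((hum s).toLp _)
        (translate (if s then b⁻¹ else -b⁻¹) f)) F := by
      refine hasSum_of_disjoint hdisj ?_ fun s => ?_
      · filter_upwards [weightMul_swap_eq_zero hP hW hW0 f] with t ht htq
        exact ht fun j hj => htq j.2 (Set.mem_iUnion.2 ⟨j.1, hj⟩)
      · refine weightMul_translate_indicator hP hW _ (fun t ht => ?_) f
        obtain ⟨n, hn⟩ := Set.mem_iUnion.1 ht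
        rw [swap_of_mem hP hn]
        cases s
        · simp [shift]
        · simp [shift, sub_eq_add_neg]
    have hF := (hasSum_fintype _).unique hsum
    rw [Fintype.sum_bool] at hF
    set G : ℤ → L2 := fun k => weightMul
      (if k = 0 then hD.toLp D else (hum (decide (k = -1))).toLp _)
      (translate (-(k : ℝ) * b⁻¹) f) with hG
    have hGsum : HasSum (({-1, 0, 1} : Set ℤ).indicator G)
        (∑ k ∈ ({-1, 0, 1} : Finset ℤ), ({-1, 0, 1} : Set ℤ).indicator G k) :=
      hasSum_sum_of_ne_finset_zero fun k hk => Set.indicator_of_notMem (by simpa using hk) _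
    have h0 : G 0 = weightMul (hD.toLp D) f := by
      simp only [hG, if_true, Int.cast_zero, neg_zero, zero_mul]
      exact weightMul_translate_zero _ _
    have h1 : G 1 = weightMul ((hum false).toLp _) (translate (-b⁻¹) f) := by
      simp [hG]
    have h2 : G (-1) = weightMul ((hum true).toLp _) (translate b⁻¹ f) := by
      simp [hG]
    have hTG : T f = ∑ k ∈ ({-1, 0, 1} : Finset ℤ), ({-1, 0, 1} : Set ℤ).indicator G k := by
      rw [Finset.sum_congr rfl fun k hk => Set.indicator_of_mem
        (show k ∈ ({-1, 0, 1} : Set ℤ) by simpa using hk) G,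
        Finset.sum_insert (by decide), Finset.sum_insert (by decide), Finset.sum_singleton]
      change T f = G (-1) + (G 0 + G 1)
      rw [h0, h1, h2, hTf, ← hF]
      simp only [if_true, Bool.false_eq_true, if_false]
      abel
    rw [hTG]
    exact hasSum_subtype_iff_indicator.2 hGsum
  · filter_upwards [(hum (decide ((1 : ℤ) = -1))).coeFn_toLp] with t h1 h2
    rw [if_neg one_ne_zero, h1]
    refine Set.indicator_of_notMem (fun hh => h2 ?_) _
    obtain ⟨n, hn⟩ := Set.mem_iUnion.1 hh
    have hn' : t ∈ Set.Ico (c + n * a) (d + n * a - b⁻¹) := hn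
    exact Set.mem_iUnion.2 ⟨n, hn'.1, by linarith [hn'.2]⟩
  · filter_upwards [(hum (decide ((-1 : ℤ) = -1))).coeFn_toLp] with t h1 h2
    rw [if_neg (by decide), h1]
    refine Set.indicator_of_notMem (fun hh => h2 ?_) _
    obtain ⟨n, hn⟩ := Set.mem_iUnion.1 hh
    have hn' : t ∈ Set.Ico (c + n * a + b⁻¹) (d + n * a) := hn
    exact Set.mem_iUnion.2 ⟨n, by linarith [hn'.1], hn'.2.le⟩

/-! ### Disjointness of the cells from the parameter inequalities, and the two cases of the theorem.
-/

/-- `h1` and `h3` separate the left cells from each other, `h2` and `h3` the right cells. `hlen`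
separates the two cells of one window, and `h4` the left cell of window n from the right cell of
window n - 1. Cells may touch, which their half-open form permits. -/
lemma admissible_of_le {c d p : ℤ → ℝ} (hp : ∀ n, 0 < p n) (hlen : ∀ n, d n ≤ c n + 2 * p n)
    (hc : ∀ n, c n ≤ c (n + 1)) (h1 : ∀ n, d n - p n ≤ d (n - 1)) (h2 : ∀ n, c (n + 1) ≤ c n + p n)
    (h3 : ∀ n, d (n - 1) ≤ c (n + 1)) (h4 : ∀ n, d n - p n ≤ c (n - 1) + p (n - 1)) :
    Admissible c d p := by
  have hmono : Monotone c := monotone_int_of_le_succ hc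
  have hov : ∀ n, d n ≤ c (n + 2) := fun n => by
    have := h3 (n + 1)
    rwa [add_sub_cancel_right, add_assoc] at this
  refine ⟨hp, hlen, ?_, hmono, hov⟩
  have hLL : ∀ n m t, n < m → t ∈ cell c d p (n, false) → t ∉ cell c d p (m, false) :=
    fun n m t hnm ht ht' => by
      have := hmono (Int.add_one_le_of_lt hnm)
      linarith [ht.2, ht'.1, h1 n, h3 n]
  have hRR : ∀ n m t, n < m → t ∈ cell c d p (n, true) → t ∉ cell c d p (m, true) :=
    fun n m t hnm ht ht' => by
      have := hmono (show n + 2 ≤ m + 1 by omega)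
      linarith [ht.2, ht'.1, hov n, h2 m]
  have hLR : ∀ n m t, t ∈ cell c d p (n, false) → t ∉ cell c d p (m, true) :=
    fun n m t ht ht' => by
      rcases lt_trichotomy n m with hnm | rfl | hnm
      · have := hmono (Int.add_one_le_of_lt hnm)
        linarith [ht.2, ht'.1, h1 n, h3 n, hp m]
      · linarith [ht.2, ht'.1, hlen n]
      · rcases eq_or_lt_of_le (Int.le_sub_one_of_lt hnm) with rfl | hlt
        · linarith [ht.2, ht'.1, h4 n]
        · have := hmono (show m + 2 ≤ n by omega)
          linarith [ht.1, ht'.2, hov m]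
  rintro ⟨n, s⟩ ⟨m, s'⟩ hne
  refine Set.disjoint_left.2 fun t ht ht' => ?_
  rcases s with _ | _ <;> rcases s' with _ | _
  · rcases lt_trichotomy n m with h | rfl | h
    exacts [hLL n m t h ht ht', hne rfl, hLL m n t h ht' ht]
  · exact hLR n m t ht ht'
  · exact hLR m n t ht' ht
  · rcases lt_trichotomy n m with h | rfl | h
    exacts [hRR n m t h ht ht', hne rfl, hRR m n t h ht' ht]

/-- The bound on consecutive modulation parameters, in additive form. -/
lemma sub_lt_inv_of_lt_div {q r x : ℝ} (hq : 0 < q) (hr : 0 < r) (h : r < q / (q * x - 1)) :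
    x - q⁻¹ < r⁻¹ := by
  -- A nonpositive denominator, including 0 with the convention q / 0 = 0, would force r < 0 or r <
  -- r's lower bound 0.
  have hden : 0 < q * x - 1 := by
    by_contra hneg
    exact absurd (h.trans_le (div_nonpos_of_nonneg_of_nonpos hq.le (not_lt.1 hneg))) (not_lt.2 hr.le)
  rw [lt_div_iff₀ hden] at h
  rw [lt_inv_comm₀ (by
    rw [show x - q⁻¹ = (q * x - 1) / q by field_simp]
    positivity) hr, show (x - q⁻¹)⁻¹ = q / (q * x - 1) by
      rw [show x - q⁻¹ = (q * x - 1) / q by field_simp, inv_div], lt_div_iff₀ hden]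
  exact h

theorem nonstationary_tridiagonal (g : ℤ → L2) (b c d : ℤ → ℝ) (ε : ℝ)
    (hsupp : ∀ n, essSupport (g n) = Set.Icc (c n) (d n))
    (hb : ∀ n, 1 / (d n - c n) < b n) (hcd : ∀ n, c n < d n) (hε : 0 < ε)
    (hdc : ∀ n, d (n - 1) ≤ c (n + 1))
    (hmax : ∀ n, max ((d n - c n) / 2) (max (c (n + 1) - c n) (d n - d (n - 1))) + ε ≤ (b n)⁻¹)
    (hbb : ∀ n, 0 < b n ∧ b n < b (n - 1) / (b (n - 1) * (d n - c (n - 1)) - 1))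
    (hframe : IsFrame (nsgSystem g b)) :
    ∃ S : L2 ≃L[ℂ] L2, IsFrameOperator (nsgSystem g b) S ∧
      HasTridiagonalWalnut c d b (S.symm : L2 →L[ℂ] L2) ∧
      HasTridiagonalWalnut c d b (S : L2 →L[ℂ] L2) := by
  have hp : ∀ n, 0 < (b n)⁻¹ := fun n => inv_pos.2 (hbb n).1
  have hlt : ∀ n, (b n)⁻¹ < d n - c n := fun n => by
    rw [inv_lt_comm₀ (hbb n).1 (by linarith [hcd n]), ← one_div]
    exact hb n
  have hm1 : ∀ n, (d n - c n) / 2 + ε ≤ (b n)⁻¹ := fun n =>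
    (add_le_add_left (le_max_left _ _) _).trans (hmax n)
  have hm2 : ∀ n, c (n + 1) - c n + ε ≤ (b n)⁻¹ := fun n =>
    (add_le_add_left ((le_max_left _ _).trans (le_max_right _ _)) _).trans (hmax n)
  have hm3 : ∀ n, d n - d (n - 1) + ε ≤ (b n)⁻¹ := fun n =>
    (add_le_add_left ((le_max_right _ _).trans (le_max_right _ _)) _).trans (hmax n)
  -- Monotonicity of c comes from d_n - d_{n-1} < 1/b_n < d_n - c_n, so that c_n < d_{n-1} ≤
  -- c_{n+1}. The bound on b_n by b_{n-1} is exactly the separation of neighbouring left and right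
  -- cells.
  have hadm : Admissible c d fun n => (b n)⁻¹ :=
    admissible_of_le hp (fun n => by linarith [hm1 n])
      (fun n => by linarith [hlt n, hm3 n, hdc n]) (fun n => by linarith [hm3 n])
      (fun n => by linarith [hm2 n]) hdc fun n => by
        linarith [sub_lt_inv_of_lt_div (hbb (n - 1)).1 (hbb n).1 (hbb n).2]
  obtain ⟨S, hS, D, W, D', W', hD, hW, hD', hW', h0, hSf, hSf'⟩ :=
    exists_frameOperator_eq_swapOp hadm
      (fun n => ae_eq_zero_of_essSupport_subset (hsupp n).subset) hframe
  exact ⟨S, hS,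
    hasTridiagonalWalnut_of_eq_swapOp hadm.disj hD' hW' (fun t ht => (h0 t ht).2) hSf',
    hasTridiagonalWalnut_of_eq_swapOp hadm.disj hD hW (fun t ht => (h0 t ht).1) hSf⟩

lemma translate_eq_zero {g : L2} {c d : ℝ} (h : ∀ᵐ t, t ∉ Set.Icc c d → g t = 0) (x : ℝ) :
    ∀ᵐ t, t ∉ Set.Icc (c + x) (d + x) → translate x g t = 0 := by
  have h' := (measurePreserving_sub_right (volume : Measure ℝ) x).quasiMeasurePreserving.ae h
  filter_upwards [h', coeFn_translate x g] with t h1 h2 h3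
  rw [h2]
  exact h1 fun hh => h3 ⟨by linarith [hh.1], by linarith [hh.2]⟩

theorem gabor_tridiagonal (g : L2) (a b c d : ℝ) (hcd : c < d)
    (hsupp : essSupport g ⊆ Set.Icc c d) (ha : (d - c) / 2 ≤ a) (hb : 0 < b) (hba : b < 1 / a)
    (hbda : b < 2 / (d - c + a)) (hframe : IsFrame (gaborSystem g a b)) :
    ∃ S : L2 ≃L[ℂ] L2, IsFrameOperator (gaborSystem g a b) S ∧
      HasTridiagonalGaborWalnut c d a b (S.symm : L2 →L[ℂ] L2) ∧
      HasTridiagonalGaborWalnut c d a b (S : L2 →L[ℂ] L2) := by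
  have ha0 : 0 < a := by linarith
  have hpa : a < b⁻¹ := by
    rw [lt_inv_comm₀ ha0 hb, ← one_div]
    exact hba
  have hp2 : (d - c + a) / 2 < b⁻¹ := by
    rw [lt_inv_comm₀ (by linarith) hb, inv_div]
    exact hbda
  -- The condition d_{n-1} ≤ c_{n+1} reads d - c ≤ 2a, and the separation of neighbouring cells
  -- reads d - c + a ≤ 2/b, which also gives d - c ≤ 2/b.
  have hadm : Admissible (fun n : ℤ => c + n * a) (fun n => d + n * a) fun _ => b⁻¹ := by
    refine admissible_of_le (fun _ => inv_pos.2 hb) ?_ ?_ ?_ ?_ ?_ ?_ <;> intro n <;>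
      push_cast <;> nlinarith
  obtain ⟨S, hS, D, W, D', W', hD, hW, hD', hW', h0, hSf, hSf'⟩ :=
    exists_frameOperator_eq_swapOp (b := fun _ => b) (g := fun n : ℤ => translate (n * a) g) hadm
      (fun n => translate_eq_zero (ae_eq_zero_of_essSupport_subset hsupp) _) hframe
  exact ⟨S, hS,
    hasTridiagonalGaborWalnut_of_eq_swapOp hadm.disj hD' hW' (fun t ht => (h0 t ht).2) hSf',
    hasTridiagonalGaborWalnut_of_eq_swapOp hadm.disj hD hW (fun t ht => (h0 t ht).1) hSf⟩

end NSGabor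

end

theorem mainTheorem6 :
    (∀ (g : ℤ → NSGabor.L2) (b c d : ℤ → ℝ) (ε : ℝ),
      (∀ n, c n < d n) →
      (∀ n, NSGabor.essSupport (g n) = Set.Icc (c n) (d n)) →
      (∀ n, 1 / (d n - c n) < b n) →
      0 < ε →
      (∀ n, d (n - 1) ≤ c (n + 1)) →
      (∀ n, max ((d n - c n) / 2) (max (c (n + 1) - c n) (d n - d (n - 1))) + ε ≤ (b n)⁻¹) →
      (∀ n, 0 < b n ∧ b n < b (n - 1) / (b (n - 1) * (d n - c (n - 1)) - 1)) →
      NSGabor.IsFrame (NSGabor.nsgSystem g b) →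
      ∃ S : NSGabor.L2 ≃L[ℂ] NSGabor.L2,
        NSGabor.IsFrameOperator (NSGabor.nsgSystem g b) S ∧
        NSGabor.HasTridiagonalWalnut c d b (S.symm : NSGabor.L2 →L[ℂ] NSGabor.L2) ∧
        NSGabor.HasTridiagonalWalnut c d b (S : NSGabor.L2 →L[ℂ] NSGabor.L2)) ∧
    (∀ (g : NSGabor.L2) (a b c d : ℝ),
      c < d →
      NSGabor.essSupport g ⊆ Set.Icc c d →
      (d - c) / 2 ≤ a → a < d - c →
      0 < b → b < 1 / a → b < 2 / (d - c + a) →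
      NSGabor.IsFrame (NSGabor.gaborSystem g a b) →
      ∃ S : NSGabor.L2 ≃L[ℂ] NSGabor.L2,
        NSGabor.IsFrameOperator (NSGabor.gaborSystem g a b) S ∧
        NSGabor.HasTridiagonalGaborWalnut c d a b (S.symm : NSGabor.L2 →L[ℂ] NSGabor.L2) ∧
        NSGabor.HasTridiagonalGaborWalnut c d a b (S : NSGabor.L2 →L[ℂ] NSGabor.L2)) := by
  exact ⟨fun g b c d ε hcd hsupp hb hε hdc hmax hbb hframe =>
      NSGabor.nonstationary_tridiagonal g b c d ε hsupp hb hcd hε hdc hmax hbb hframe,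
    fun g a b c d hcd hsupp ha _ hb hba hbda hframe =>
      NSGabor.gabor_tridiagonal g a b c d hcd hsupp ha hb hba hbda hframe⟩
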